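/- Let $V$ be a complex vector space of dimension $n\ge 5$ with basis $e_1,\dots,e_n$, and write products in the exterior algebra without $\wedge$. Let $X=\operatorname{Gr}(3,V)\subset\mathbb P(\bigwedge^3V)$ in its Plücker embedding. Let $\sigma_2(X)$ be its chordal (secant) variety, i.e. the Zariski closure of the union of the spans of pairs of points of $X$, and let $\sigma_2^1(X)$ be the Zariski closure of the set of points $[\lambda_1\widehat E_1+\lambda_2\widehat E_2]$ with $E_1,E_2\subset V$ of dimension $3$ and $\dim(E_1\cap E_2)\ge 1$, where $\widehat E$ is a nonzero vector on the Plücker line of $E$. For a projective variety $Y$ and a point $x$ of its affine cone, $\widehat T_xY$ denotes the set of velocities $\gamma'(0)$ of holomorphic curve germs $\gamma$ in the affine cone over $Y$ with $\gamma(0)=x$. For a set $S\subset\bigwedge^2V$ let $V\cdot S$ be the span of all products $vw$ with $v\in V$, $w\in S$. Put $\widehat T_{ijk}=\widehat T_{e_ie_je_k}X$ and $D=\operatorname{span}\{e_ie_2e_3-e_ie_4e_5\mid 6\le i\le n\}$. Then: 1. $\widehat T_{e_1e_2e_3+e_1e_4e_5}\,\sigma_2^1(X)=V\cdot\{e_2e_3+e_4e_5,\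 e_1e_2,\ e_1e_3,\ e_1e_4,\ e_1e_5\}$. 2. $\widehat T_{123}=V\cdot\{e_1e_2,e_1e_3,e_2e_3\}$ and $\widehat T_{145}=V\cdot\{e_1e_4,e_1e_5,e_4e_5\}$. The space $\widehat T_{123}\cap\widehat T_{145}$ has basis $e_1e_2e_4,\ e_1e_2e_5,\ e_1e_3e_4,\ e_1e_3e_5$. One has $\dim D=n-5$ and $$\widehat T_{123}+\widehat T_{145}=\widehat T_{e_1e_2e_3+e_1e_4e_5}\,\sigma_2^1(X)\oplus D .$$ If $n\ge 6$, then moreover $$\widehat T_{e_1e_2e_3+e_4e_5e_6}\,\sigma_2(X)=\widehat T_{123}\oplus\widehat T_{456}=V\cdot\{e_1e_2,e_1e_3,e_2e_3,e_4e_5,e_4e_6,e_5e_6\},$$ and there is an isomorphism of vector spaces $$\widehat T_{e_1e_2e_3+e_4e_5e_6}\,\sigma_2(X)\;\cong\;\widehat T_{e_1e_2e_3+e_1e_4e_5}\,\sigma_2^1(X)\,\oplus\, D\,\oplus\,\bigl(\widehat T_{123}\cap\widehat T_{145}\bigr).$$ 3. $\dim\sigma_2^1(X)=5n-16$. If $n\ge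 6$, then $\sigma_2^1(X)$ is contained in $\sigma_2(X)$ with codimension $n-1$; if $n=5$, then $\sigma_2^1(X)=\sigma_2(X)$. -/

import Mathlib

open scoped LinearAlgebra.Projectivization Topology Pointwise

noncomputable section

namespace RestrictedSecant

/-! ## Projective geometry in `ℙ W` for a finite-dimensional complex vector space `W` -/

section Projective

variable {W : Type*} [AddCommGroup W] [Module ℂ W]

/-- The value at `w` of a polynomial in the linear forms on `W`.  Every polynomial function on a
finite-dimensional `W` arises in this way, without a choice of coordinates, and the homogeneous
polynomial functions of degree `d` come from the homogeneous `F` of degree `d`. -/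
def evalAt (F : MvPolynomial (Module.Dual ℂ W) ℂ) (w : W) : ℂ :=
  MvPolynomial.eval (fun φ : Module.Dual ℂ W => φ w) F

/-- The Zariski closure of `S ⊆ ℙ W`: the common zeros of all homogeneous polynomials that
vanish on `S`. -/
def zariskiClosure (S : Set (ℙ ℂ W)) : Set (ℙ ℂ W) :=
  {p | ∀ (d : ℕ) (F : MvPolynomial (Module.Dual ℂ W) ℂ), F.IsHomogeneous d →
    (∀ q ∈ S, evalAt F q.rep = 0) → evalAt F p.rep = 0}

/-- The affine cone in `W` over `X ⊆ ℙ W` (with its vertex `0`). -/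
def cone (X : Set (ℙ ℂ W)) : Set W :=
  {w | ∀ hw : w ≠ 0, Projectivization.mk ℂ w hw ∈ X}

/-- The ideal of all polynomials that vanish on the affine cone over `X`. -/
def vanishingIdeal (X : Set (ℙ ℂ W)) : Ideal (MvPolynomial (Module.Dual ℂ W) ℂ) where
  carrier := {F | ∀ w ∈ cone X, evalAt F w = 0}
  add_mem' := by
    intro F G hF hG w hw
    have h1 := hF w hw
    have h2 := hG w hw
    simp only [evalAt] at h1 h2 ⊢
    rw [map_add, h1, h2, add_zero]
  zero_mem' := by
    intro w _
    simp [evalAt]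
  smul_mem' := by
    intro G F hF w hw
    have h1 := hF w hw
    simp only [evalAt] at h1 ⊢
    rw [smul_eq_mul, map_mul, h1, mul_zero]

/-- The homogeneous coordinate ring of `X ⊆ ℙ W`. -/
abbrev CoordinateRing (X : Set (ℙ ℂ W)) : Type _ :=
  MvPolynomial (Module.Dual ℂ W) ℂ ⧸ vanishingIdeal X

/-- The projective variety `X` has dimension `d`: its homogeneous coordinate ring (the coordinate
ring of the affine cone over `X`) has Krull dimension `d + 1`. -/
def HasDim (X : Set (ℙ ℂ W)) (d : ℕ) : Prop :=
  ringKrullDim (CoordinateRing X) = ((d + 1 : ℕ) : WithBot ℕ∞)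

/-- `Y` is contained in `X` with codimension `c`, that is `dim X = dim Y + c`. -/
def HasCodimIn (Y X : Set (ℙ ℂ W)) (c : ℕ) : Prop :=
  Y ⊆ X ∧ ∃ d : ℕ, HasDim Y d ∧ HasDim X (d + c)

/-- The `s`-secant variety of `X ⊆ ℙ W`: the Zariski closure of the set of points that lie in the
span of `s` points of `X`. -/
def secantVariety (s : ℕ) (X : Set (ℙ ℂ W)) : Set (ℙ ℂ W) :=
  zariskiClosure {p | ∃ x : Fin s → ℙ ℂ W, (∀ i, x i ∈ X) ∧
    p.submodule ≤ ⨆ i, (x i).submodule}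

/-- The cone over the tangent space of `X` at (the class of) `x`: the set of all velocities
`γ'(0)` of holomorphic curve germs `γ` in the affine cone over `X` with `γ(0) = x`.
A map into the finite-dimensional space `W` is holomorphic with derivative `v` at `0` when
this holds after composition with every linear form. -/
def coneTangentSpace (X : Set (ℙ ℂ W)) (x : W) : Set W :=
  {v | ∃ γ : ℂ → W, γ 0 = x ∧ (∀ᶠ t in 𝓝 (0 : ℂ), γ t ∈ cone X) ∧
    ∀ φ : Module.Dual ℂ W,
      AnalyticAt ℂ (fun t => φ (γ t)) 0 ∧ HasDerivAt (fun t => φ (γ t)) (φ v) 0}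

end Projective

/-! ## Grassmannians and their restricted secant varieties -/

section Grassmannian

variable {V : Type*} [AddCommGroup V] [Module ℂ V]

/-- The line in `⋀^k V` that the Plücker embedding attaches to a `k`-plane `E`: it is spanned by
`v₁ ∧ ⋯ ∧ v_k` for any basis `v₁, …, v_k` of `E`. -/
def pluckerLine (k : ℕ) (E : Submodule ℂ V) : Submodule ℂ (⋀[ℂ]^k V) :=
  LinearMap.range (exteriorPower.map k E.subtype)

variable (V) in
/-- The Grassmannian `Gr(k, V)` in its Plücker embedding into `ℙ (⋀^k V)`. -/
def grassmannian (k : ℕ) : Set (ℙ ℂ (⋀[ℂ]^k V)) :=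
  {p | ∃ E : Submodule ℂ V, Module.finrank ℂ E = k ∧ p.submodule = pluckerLine k E}

variable (V) in
/-- The `r`-restricted `s`-secant variety of `Gr(k, V)`: the Zariski closure of the set of all
points `[λ₁ Ê₁ + ⋯ + λ_s Ê_s]` with `k`-planes `E₁, …, E_s` in `V` such that
`dim (E₁ ∩ ⋯ ∩ E_s) ≥ r`. -/
def restrictedSecant (s r k : ℕ) : Set (ℙ ℂ (⋀[ℂ]^k V)) :=
  zariskiClosure {p | ∃ E : Fin s → Submodule ℂ V, (∀ i, Module.finrank ℂ (E i) = k) ∧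
    r ≤ Module.finrank ℂ (⨅ i, E i : Submodule ℂ V) ∧
    p.submodule ≤ ⨆ i, pluckerLine k (E i)}

/-- `V · S`: the span in `⋀^(k+1) V` of all products `v ∧ w` with `v ∈ V` and `w ∈ S`. -/
def dot {k : ℕ} (S : Set (⋀[ℂ]^k V)) : Submodule ℂ (⋀[ℂ]^(k + 1) V) :=
  Submodule.span ℂ {x | ∃ v : V, ∃ w ∈ S,
    (x : ExteriorAlgebra ℂ V) = ExteriorAlgebra.ι ℂ v * (w : ExteriorAlgebra ℂ V)}

variable {n : ℕ}

/-- The vectors `e₁, …, e_n` of a basis, numbered from `1` (and `0` for any other index, which is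
never used). -/
def vec (e : Module.Basis (Fin n) ℂ V) (i : ℕ) : V :=
  if h : 1 ≤ i ∧ i ≤ n then e ⟨i - 1, by omega⟩ else 0

/-- `e_i ∧ e_j`. -/
def e2 (e : Module.Basis (Fin n) ℂ V) (i j : ℕ) : ⋀[ℂ]^2 V :=
  exteriorPower.ιMulti ℂ 2 ![vec e i, vec e j]

/-- `e_i ∧ e_j ∧ e_k`. -/
def e3 (e : Module.Basis (Fin n) ℂ V) (i j k : ℕ) : ⋀[ℂ]^3 V :=
  exteriorPower.ιMulti ℂ 3 ![vec e i, vec e j, vec e k]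

/-- The span of the vectors `e_i e_2 e_3 - e_i e_4 e_5` with `6 ≤ i ≤ n`. -/
def extraSpan (e : Module.Basis (Fin n) ℂ V) : Submodule ℂ (⋀[ℂ]^3 V) :=
  Submodule.span ℂ {x | ∃ i : ℕ, 6 ≤ i ∧ i ≤ n ∧ x = e3 e i 2 3 - e3 e i 4 5}

end Grassmannian

end RestrictedSecant

end

noncomputable section

namespace RestrictedSecant

/-! ## Krull dimension and transcendence degree -/

/-! The cone over each set of secant points is the set of images of one fixed trivector under all
linear maps `ℂ^r → V`: `ξ5` with r = 5 for secants through meeting planes, `ξ6` with r = 6 for all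
secants. Everything rests on this description.

Tangent spaces. Curves obtained by moving each factor of a product linearly give all the asserted
tangent vectors by the Leibniz rule. For the converse, a trivector coming from `ℂ^r` has contraction
map `⋀²V* → V` of rank at most r, so all (r+1)-minors of this map vanish on the closure. At the
given point the rank is exactly r. Bordering an identity r×r block by a form and a contraction that
both annihilate the point, and differentiating the minor, gives a linear equation on tangent vectors
(`contraction_eq_zero_of_mem_coneTangentSpace`). Read in Plücker coordinates, these equations cut
out exactly the asserted spaces. The Grassmannian is the case r = 3.

Linear algebra. The spaces `T̂` at products of basis vectors are spanned by monomials with at least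
two indices in a given triple, so their intersections are read off from index sets. Only e_k(e₂e₃ +
e₄e₅), k ≥ 6, mixes monomials, and `D` supplies the missing differences.

Dimension. A subspace of tangent vectors bounds the transcendence degree of the coordinate ring from
below (`le_trdeg_coordinateRing`). From above it is bounded by the number of parameters of
trivectors supported on an r-plane: `r.choose 3` for the trivector and r(n-r) for the plane
(`evalAt_map_eq_zero`). The two bounds agree for r = 5 and r = 6. The coordinate ring is a domain
because the cone is parametrized by a vector space, so its transcendence degree is its Krull
dimension. -/

theorem ringKrullDim_eq_of_isIntegral_of_injective {R S : Type*} [CommRing R] [CommRing S]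
    (f : R →+* S) (hf : Function.Injective f) (hint : f.IsIntegral) :
    ringKrullDim S = ringKrullDim R := by
  let _ := f.toAlgebra
  have hi : Algebra.IsIntegral R S := ⟨hint⟩
  apply le_antisymm
  -- Incomparability: contraction of primes along an integral map is strictly monotone.
  · refine Order.krullDim_le_of_strictMono
      (fun I ↦ (⟨Ideal.comap (algebraMap R S) I.asIdeal, inferInstance⟩ : PrimeSpectrum R)) ?_
    intro I J hIJ
    exact Ideal.IsIntegral.comap_lt_comap (R := R) (I := I.asIdeal) (J := J.asIdeal) hIJ
  -- Lying over and going up: a chain in `R` lifts to a chain of the same length in `S`.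
  · refine iSup_le fun l ↦ ?_
    obtain ⟨P, -, hP, hPl⟩ := Ideal.exists_ideal_over_prime_of_isIntegral (S := S)
      l.head.asIdeal ⊥ (by
        rw [← RingHom.ker_eq_comap_bot, (RingHom.injective_iff_ker_eq_bot (algebraMap R S)).mp hf]
        exact bot_le)
    have : P.LiesOver l.head.asIdeal := ⟨hPl.symm⟩
    obtain ⟨L, hL, -⟩ := Ideal.exists_ltSeries_of_hasGoingUp l P
    rw [← hL]
    exact le_iSup (fun p : LTSeries (PrimeSpectrum S) ↦ ((p.length : ℕ∞) : WithBot ℕ∞)) L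

/-- Noether normalization: `A` is integral over a polynomial ring in s variables, and neither Krull
dimension nor transcendence degree changes in an injective integral extension, so both equal s. -/
theorem ringKrullDim_eq_of_trdeg {k A : Type*} [Field k] [CommRing A] [IsDomain A] [Algebra k A]
    [Algebra.FiniteType k A] {n : ℕ} (h : Algebra.trdeg k A = n) : ringKrullDim A = n := by
  obtain ⟨s, g, hg, hint⟩ := exists_integral_inj_algHom_of_fg k A
  have h1 : ringKrullDim A = s := by
    rw [ringKrullDim_eq_of_isIntegral_of_injective g.toRingHom hg hint,
      MvPolynomial.ringKrullDim_of_isNoetherianRing, ringKrullDim_eq_zero_of_field]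
    simp
  let _ := g.toRingHom.toAlgebra
  have : IsScalarTower k (MvPolynomial (Fin s) k) A :=
    IsScalarTower.of_algebraMap_eq fun x ↦ (g.commutes x).symm
  have : Algebra.IsIntegral (MvPolynomial (Fin s) k) A := ⟨hint⟩
  have : FaithfulSMul (MvPolynomial (Fin s) k) A :=
    (faithfulSMul_iff_algebraMap_injective _ _).mpr hg
  have h2 := lift_trdeg_add_eq k (MvPolynomial (Fin s) k) A
  rw [trdeg_eq_zero (R := MvPolynomial (Fin s) k), MvPolynomial.trdeg_of_isDomain, h] at h2
  simp at h2
  rw [h1, h2]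

/-! ## Polynomial functions -/

section Poly

variable {W : Type*} [AddCommGroup W] [Module ℂ W]

theorem evalAt_smul {F : MvPolynomial (Module.Dual ℂ W) ℂ} {d : ℕ} (hF : F.IsHomogeneous d)
    (c : ℂ) (w : W) : evalAt F (c • w) = c ^ d * evalAt F w := by
  simp only [evalAt, map_smul, smul_eq_mul]
  rw [MvPolynomial.eval_eq, MvPolynomial.eval_eq, Finset.mul_sum]
  refine Finset.sum_congr rfl fun m hm ↦ ?_
  have h := hF (MvPolynomial.mem_support_iff.mp hm)
  simp only [mul_pow, Finset.prod_mul_distrib, Finset.prod_pow_eq_pow_sum]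
  have : ∑ i ∈ m.support, m i = d := by
    rw [← h, Finsupp.weight_apply]; simp [Finsupp.sum]
  rw [this]; ring

theorem evalAt_eq_sum_homogeneousComponent (F : MvPolynomial (Module.Dual ℂ W) ℂ) (w : W) :
    evalAt F w = ∑ i ∈ Finset.range (F.totalDegree + 1),
      evalAt (MvPolynomial.homogeneousComponent i F) w := by
  conv_lhs => rw [← MvPolynomial.sum_homogeneousComponent F]
  simp [evalAt]

/-- On the line through `w`, `F` is a polynomial in the scalar c whose coefficients are the values
at `w` of its homogeneous components. -/
theorem evalAt_homogeneousComponent_eq_zero {F : MvPolynomial (Module.Dual ℂ W) ℂ} {w : W}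
    (h : ∀ c : ℂ, evalAt F (c • w) = 0) (i : ℕ) :
    evalAt (MvPolynomial.homogeneousComponent i F) w = 0 := by
  by_cases hi : i ∈ Finset.range (F.totalDegree + 1)
  · let q : Polynomial ℂ := ∑ i ∈ Finset.range (F.totalDegree + 1),
      Polynomial.C (evalAt (MvPolynomial.homogeneousComponent i F) w) * Polynomial.X ^ i
    have hq : q = 0 := by
      refine Polynomial.funext fun c ↦ ?_
      have := h c
      rw [evalAt_eq_sum_homogeneousComponent] at this
      rw [Polynomial.eval_zero, ← this, Polynomial.eval_finsetSum]
      refine Finset.sum_congr rfl fun j _ ↦ ?_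
      rw [evalAt_smul (MvPolynomial.homogeneousComponent_isHomogeneous j F)]
      rw [Polynomial.eval_C_mul, Polynomial.eval_pow, Polynomial.eval_X, mul_comm]
    have := congrArg (fun r ↦ Polynomial.coeff r i) hq
    simpa [q, Polynomial.finsetSum_coeff, Polynomial.coeff_C_mul, Polynomial.coeff_X_pow, hi,
      -Finset.mem_range, -Order.lt_add_one_iff] using this
  · rw [MvPolynomial.homogeneousComponent_eq_zero]
    · simp [evalAt]
    · simpa using hi

theorem smul_mem_cone {X : Set (ℙ ℂ W)} {w : W} (h : w ∈ cone X) (c : ℂ) : c • w ∈ cone X := by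
  intro hw
  have hw0 : w ≠ 0 := fun h0 ↦ hw (by simp [h0])
  have hc : c ≠ 0 := fun h0 ↦ hw (by simp [h0])
  have : Projectivization.mk ℂ (c • w) hw = Projectivization.mk ℂ w hw0 :=
    (Projectivization.mk_eq_mk_iff' ℂ _ _ hw hw0).mpr ⟨c, rfl⟩
  rw [this]
  exact h hw0

theorem rep_mem_cone {X : Set (ℙ ℂ W)} {p : ℙ ℂ W} (hp : p ∈ X) : p.rep ∈ cone X := by
  intro _
  rwa [Projectivization.mk_rep]

theorem zero_mem_cone (X : Set (ℙ ℂ W)) : (0 : W) ∈ cone X := fun h ↦ (h rfl).elim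

theorem subset_zariskiClosure (S : Set (ℙ ℂ W)) : S ⊆ zariskiClosure S :=
  fun p hp _ _ _ h ↦ h p hp

theorem zariskiClosure_mono {S S' : Set (ℙ ℂ W)} (h : S ⊆ S') :
    zariskiClosure S ⊆ zariskiClosure S' :=
  fun _ hp d F hF hS ↦ hp d F hF fun q hq ↦ hS q (h hq)

theorem cone_mono {S S' : Set (ℙ ℂ W)} (h : S ⊆ S') : cone S ⊆ cone S' :=
  fun _ hw h0 ↦ h (hw h0)

/-- A polynomial vanishing on the cone over `S` vanishes on the cone over its Zariski closure. -/
theorem evalAt_eq_zero_of_mem_cone_zariskiClosure {S : Set (ℙ ℂ W)}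
    {F : MvPolynomial (Module.Dual ℂ W) ℂ} (hF : ∀ w ∈ cone S, evalAt F w = 0)
    {w : W} (hw : w ∈ cone (zariskiClosure S)) : evalAt F w = 0 := by
  -- The closure is defined by homogeneous polynomials only, so `F` is split; the pieces vanish on
  -- `cone S` because it is stable under scalars.
  have hcomp : ∀ i, ∀ u ∈ cone S, evalAt (MvPolynomial.homogeneousComponent i F) u = 0 :=
    fun i u hu ↦ evalAt_homogeneousComponent_eq_zero (fun c ↦ hF _ (smul_mem_cone hu c)) i
  by_cases hw0 : w = 0
  · rw [hw0]; exact hF 0 (zero_mem_cone S)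
  rw [evalAt_eq_sum_homogeneousComponent]
  refine Finset.sum_eq_zero fun i _ ↦ ?_
  have h1 := hw hw0 i _ (MvPolynomial.homogeneousComponent_isHomogeneous i F)
    (fun q hq ↦ hcomp i _ (rep_mem_cone hq))
  obtain ⟨a, ha⟩ := Projectivization.exists_smul_eq_mk_rep ℂ w hw0
  rw [← ha, Units.smul_def, evalAt_smul (MvPolynomial.homogeneousComponent_isHomogeneous i F)] at h1
  exact (mul_eq_zero.mp h1).resolve_left (pow_ne_zero _ a.ne_zero)

/-- Reduces membership in the ideal of a closure to the explicit points that generate it. -/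
theorem mem_vanishingIdeal_zariskiClosure {S : Set (ℙ ℂ W)}
    {F : MvPolynomial (Module.Dual ℂ W) ℂ} :
    F ∈ vanishingIdeal (zariskiClosure S) ↔ ∀ w ∈ cone S, evalAt F w = 0 :=
  ⟨fun h w hw ↦ h w (cone_mono (subset_zariskiClosure S) hw),
    fun h _ hw ↦ evalAt_eq_zero_of_mem_cone_zariskiClosure h hw⟩

/-- The restriction of a polynomial function to a polynomial curve is a polynomial. -/
theorem exists_polynomial_evalAt_curve (F : MvPolynomial (Module.Dual ℂ W) ℂ) (m : ℕ)
    (w : ℕ → W) : ∃ q : Polynomial ℂ, ∀ t : ℂ,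
      evalAt F (∑ i ∈ Finset.range m, t ^ i • w i) = q.eval t := by
  refine ⟨MvPolynomial.aeval (fun φ : Module.Dual ℂ W ↦
    ∑ i ∈ Finset.range m, Polynomial.C (φ (w i)) * Polynomial.X ^ i) F, fun t ↦ ?_⟩
  rw [MvPolynomial.aeval_def, ← Polynomial.coe_evalRingHom, MvPolynomial.hom_eval₂]
  simp only [evalAt, MvPolynomial.eval, MvPolynomial.coe_eval₂Hom]
  congr 1
  · ext; simp
  · ext φ
    change φ _ = Polynomial.evalRingHom t _
    rw [Polynomial.coe_evalRingHom, Polynomial.eval_finsetSum, map_sum]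
    refine Finset.sum_congr rfl fun i _ ↦ ?_
    rw [Polynomial.eval_C_mul, Polynomial.eval_pow, Polynomial.eval_X, mul_comm, map_smul,
      smul_eq_mul]

/-- The polynomial ring has one variable for every linear form, but modulo the vanishing ideal each
variable is a linear combination of those of a basis of the dual space, as both sides agree as
functions. -/
instance finiteType_coordinateRing [FiniteDimensional ℂ W] (X : Set (ℙ ℂ W)) :
    Algebra.FiniteType ℂ (CoordinateRing X) := by
  let b := Module.finBasis ℂ (Module.Dual ℂ W)
  let f : MvPolynomial (Fin (Module.finrank ℂ (Module.Dual ℂ W))) ℂ →ₐ[ℂ] CoordinateRing X :=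
    (Ideal.Quotient.mkₐ ℂ (vanishingIdeal X)).comp
      (MvPolynomial.aeval fun i ↦ MvPolynomial.X (b i))
  refine Algebra.FiniteType.of_surjective f ?_
  rw [← AlgHom.range_eq_top, eq_top_iff]
  rintro x -
  obtain ⟨F, rfl⟩ := Ideal.Quotient.mk_surjective x
  induction F using MvPolynomial.induction_on with
  | C a => exact ⟨MvPolynomial.C a, by simp [f]; rfl⟩
  | add p q hp hq => rw [map_add]; exact add_mem hp hq
  | mul_X p φ hp =>
    rw [map_mul]
    refine mul_mem hp ⟨∑ i, MvPolynomial.C (b.repr φ i) * MvPolynomial.X i, ?_⟩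
    refine Ideal.Quotient.eq.mpr fun w _ ↦ ?_
    have h : φ w = ∑ i, b.repr φ i * b i w := by
      conv_lhs => rw [← b.sum_repr φ]
      simp only [LinearMap.sum_apply, LinearMap.smul_apply, smul_eq_mul]
    simp [evalAt, h, MvPolynomial.algebraMap_eq]

end Poly

/-! ## Tangent vectors and the dimension of a projective variety -/

section Tangent

open Filter

/-- A polynomial vanishing along curves through the origin in every direction is zero. -/
theorem eq_zero_of_eval_curves_zero {N : ℕ} (P : MvPolynomial (Fin N) ℂ)
    (h : ∀ τ : Fin N → ℂ, ∃ g : ℂ → Fin N → ℂ, g 0 = 0 ∧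
      (∀ i, HasDerivAt (fun t ↦ g t i) (τ i) 0) ∧
      ∀ᶠ t in 𝓝 (0 : ℂ), MvPolynomial.eval (g t) P = 0) : P = 0 := by
  classical
  by_contra hP
  have hex : ∃ d, MvPolynomial.homogeneousComponent d P ≠ 0 := by
    by_contra! hall
    exact hP (by rw [← MvPolynomial.sum_homogeneousComponent P]; simp [hall])
  -- The lowest nonzero component of `P` has degree d. Dividing P(g(t)) by t^d and letting t → 0
  -- leaves the value of this component at τ.
  set d := Nat.find hex with hd
  have hdne : MvPolynomial.homogeneousComponent d P ≠ 0 := Nat.find_spec hex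
  have hlt : ∀ i < d, MvPolynomial.homogeneousComponent i P = 0 := fun i hi ↦ by
    simpa using Nat.find_min hex hi
  have hdmem : d ∈ Finset.range (P.totalDegree + 1) := by
    by_contra hcon
    exact hdne (MvPolynomial.homogeneousComponent_eq_zero _ _ (by simpa using hcon))
  refine hdne (MvPolynomial.funext fun τ ↦ ?_)
  rw [map_zero]
  obtain ⟨g, hg0, hgd, hgP⟩ := h τ
  have hy : Tendsto (fun t : ℂ ↦ t⁻¹ • g t) (𝓝[≠] 0) (𝓝 τ) := by
    refine tendsto_pi_nhds.mpr fun i ↦ ?_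
    have := (hasDerivAt_iff_tendsto_slope_zero.mp (hgd i))
    simpa [hg0] using this
  have hterm : ∀ i ∈ Finset.range (P.totalDegree + 1),
      Tendsto (fun t : ℂ ↦ t ^ (i - d) *
        MvPolynomial.eval (t⁻¹ • g t) (MvPolynomial.homogeneousComponent i P)) (𝓝[≠] 0)
        (𝓝 (if i = d then MvPolynomial.eval τ (MvPolynomial.homogeneousComponent d P) else 0)) := by
    intro i _
    have h1 : Tendsto (fun t : ℂ ↦ MvPolynomial.eval (t⁻¹ • g t)
        (MvPolynomial.homogeneousComponent i P)) (𝓝[≠] 0)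
        (𝓝 (MvPolynomial.eval τ (MvPolynomial.homogeneousComponent i P))) :=
      ((MvPolynomial.continuous_eval _).tendsto τ).comp hy
    rcases lt_trichotomy i d with hi | hi | hi
    · simp [hlt i hi, hi.ne]
    · subst hi; simpa using h1
    · rw [if_neg hi.ne']
      have h2 : Tendsto (fun t : ℂ ↦ t ^ (i - d)) (𝓝[≠] 0) (𝓝 0) := by
        have : Tendsto (fun t : ℂ ↦ t ^ (i - d)) (𝓝 0) (𝓝 (0 ^ (i - d))) :=
          (continuous_pow _).tendsto 0
        rw [zero_pow (by omega)] at this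
        exact this.mono_left nhdsWithin_le_nhds
      simpa using h2.mul h1
  have hsum := tendsto_finsetSum _ hterm
  rw [Finset.sum_ite_eq' , if_pos hdmem] at hsum
  refine tendsto_nhds_unique hsum (tendsto_const_nhds.congr' ?_)
  filter_upwards [hgP.filter_mono nhdsWithin_le_nhds, self_mem_nhdsWithin] with t ht ht0
  have ht0 : t ≠ 0 := ht0
  have hcomp : ∀ i, MvPolynomial.eval (g t) (MvPolynomial.homogeneousComponent i P) =
      t ^ i * MvPolynomial.eval (t⁻¹ • g t) (MvPolynomial.homogeneousComponent i P) := by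
    intro i
    rw [MvPolynomial.eval_eq, MvPolynomial.eval_eq, Finset.mul_sum]
    refine Finset.sum_congr rfl fun m hm ↦ ?_
    have h := MvPolynomial.homogeneousComponent_isHomogeneous i P
      (MvPolynomial.mem_support_iff.mp hm)
    have : ∑ i ∈ m.support, m i = i := by
      rw [← h, Finsupp.weight_apply]; simp [Finsupp.sum]
    simp only [Pi.smul_apply, smul_eq_mul, mul_pow, Finset.prod_mul_distrib,
      Finset.prod_pow_eq_pow_sum, this]
    rw [mul_left_comm, ← mul_assoc (t ^ i), ← mul_pow, mul_inv_cancel₀ ht0, one_pow, one_mul]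
  rw [← MvPolynomial.sum_homogeneousComponent P, map_sum] at ht
  have h3 : t ^ d * ∑ i ∈ Finset.range (P.totalDegree + 1), t ^ (i - d) *
      MvPolynomial.eval (t⁻¹ • g t) (MvPolynomial.homogeneousComponent i P) = 0 := by
    rw [← ht, Finset.mul_sum]
    refine Finset.sum_congr rfl fun i _ ↦ ?_
    rw [hcomp]
    rcases lt_or_ge i d with hi | hi
    · simp [hlt i hi]
    · rw [← mul_assoc, ← pow_add, Nat.add_sub_cancel' hi]
  exact ((mul_eq_zero.mp h3).resolve_left (pow_ne_zero _ ht0)).symm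

theorem eq_zero_of_eval_curves {N : ℕ} (P : MvPolynomial (Fin N) ℂ) (c : Fin N → ℂ)
    (h : ∀ τ : Fin N → ℂ, ∃ g : ℂ → Fin N → ℂ, g 0 = c ∧
      (∀ i, HasDerivAt (fun t ↦ g t i) (τ i) 0) ∧
      ∀ᶠ t in 𝓝 (0 : ℂ), MvPolynomial.eval (g t) P = 0) : P = 0 := by
  have heval : ∀ y : Fin N → ℂ, MvPolynomial.eval y
      (MvPolynomial.aeval (fun i ↦ MvPolynomial.X i + MvPolynomial.C (c i)) P :
        MvPolynomial (Fin N) ℂ) = MvPolynomial.eval (y + c) P := by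
    intro y
    rw [MvPolynomial.aeval_def, MvPolynomial.hom_eval₂]
    simp only [MvPolynomial.eval, MvPolynomial.coe_eval₂Hom]
    congr 1
    · ext; simp
    · ext i; simp
  have hQ := eq_zero_of_eval_curves_zero
    (MvPolynomial.aeval (fun i ↦ MvPolynomial.X i + MvPolynomial.C (c i)) P) fun τ ↦ by
      obtain ⟨g, h0, h1, h2⟩ := h τ
      refine ⟨fun t ↦ g t - c, by simp [h0], fun i ↦ ?_, ?_⟩
      · simpa using (h1 i).sub_const (c i)
      · filter_upwards [h2] with t ht
        rw [heval]; simpa using ht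
  refine MvPolynomial.funext fun y ↦ ?_
  have := heval (y - c)
  rw [hQ] at this
  simpa using this.symm

variable {W : Type*} [AddCommGroup W] [Module ℂ W]

theorem aeval_coordinateRing_eq_zero_iff {X : Set (ℙ ℂ W)} {ι : Type*} (z : ι → Module.Dual ℂ W)
    (P : MvPolynomial ι ℂ) :
    MvPolynomial.aeval (fun i ↦ (Ideal.Quotient.mk (vanishingIdeal X) (MvPolynomial.X (z i)) :
      CoordinateRing X)) P = 0 ↔ ∀ w ∈ cone X, MvPolynomial.eval (fun i ↦ z i w) P = 0 := by
  have h : MvPolynomial.aeval (fun i ↦ (Ideal.Quotient.mk (vanishingIdeal X)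
      (MvPolynomial.X (z i)) : CoordinateRing X)) P =
      Ideal.Quotient.mk (vanishingIdeal X) (MvPolynomial.rename z P) := by
    rw [← Ideal.Quotient.mkₐ_eq_mk ℂ, ← AlgHom.comp_apply]
    refine DFunLike.congr_fun (MvPolynomial.algHom_ext fun i ↦ ?_) P
    simp
  rw [h, Ideal.Quotient.eq_zero_iff_mem]
  refine forall₂_congr fun w _ ↦ ?_
  rw [evalAt, MvPolynomial.eval_rename]
  rfl

/-- Coordinates on `T`, extended to linear forms on `W`, are algebraically independent on `X`: a
relation would vanish along curves through one point with every velocity, so it is zero. No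
smoothness at `x` is needed. -/
theorem le_trdeg_coordinateRing [FiniteDimensional ℂ W] {X : Set (ℙ ℂ W)} {x : W}
    {T : Submodule ℂ W} (hT : (T : Set W) ⊆ coneTangentSpace X x) :
    (Module.finrank ℂ T : Cardinal) ≤ Algebra.trdeg ℂ (CoordinateRing X) := by
  let b := Module.finBasis ℂ T
  choose z hz using fun i ↦ LinearMap.exists_extend (b.coord i)
  have hind : AlgebraicIndependent ℂ (fun i ↦ (Ideal.Quotient.mk (vanishingIdeal X)
      (MvPolynomial.X (z i)) : CoordinateRing X)) := by
    rw [algebraicIndependent_iff]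
    intro P hP
    rw [aeval_coordinateRing_eq_zero_iff] at hP
    refine eq_zero_of_eval_curves P (fun i ↦ z i x) fun τ ↦ ?_
    obtain ⟨γ, h0, hX, hd⟩ := hT (b.equivFun.symm τ).2
    refine ⟨fun t i ↦ z i (γ t), by simp [h0], fun i ↦ ?_, ?_⟩
    · have h1 := (hd (z i)).2
      have h2 := LinearMap.congr_fun (hz i) (b.equivFun.symm τ)
      simp only [LinearMap.comp_apply, Submodule.subtype_apply] at h2
      rwa [h2, Module.Basis.coord_apply, ← b.equivFun_apply, LinearEquiv.apply_symm_apply] at h1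
    · filter_upwards [hX] with t ht using hP _ ht
  have := hind.lift_cardinalMk_le_trdeg
  simpa using this

/-- The coordinate ring is a quotient of the image of `ρ`, which is a subalgebra of a polynomial
ring in `κ` variables. -/
theorem trdeg_coordinateRing_le {X : Set (ℙ ℂ W)} {κ : Type} [Fintype κ]
    (ρ : MvPolynomial (Module.Dual ℂ W) ℂ →ₐ[ℂ] MvPolynomial κ ℂ)
    (hρ : RingHom.ker ρ ≤ vanishingIdeal X) :
    Algebra.trdeg ℂ (CoordinateRing X) ≤ Fintype.card κ := by
  have h1 := trdeg_le_of_surjective (R := ℂ) (Ideal.Quotient.factorₐ ℂ hρ)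
    (Ideal.Quotient.factor_surjective hρ)
  have h2 := lift_trdeg_le_of_injective (Ideal.kerLiftAlg ρ) (Ideal.kerLiftAlg_injective ρ)
  rw [MvPolynomial.trdeg_of_isDomain] at h2
  simp at h2
  exact h1.trans h2

theorem hasDim_of_tangent_of_ker_le [FiniteDimensional ℂ W] {X : Set (ℙ ℂ W)}
    (hX : (vanishingIdeal X).IsPrime) {x : W} {T : Submodule ℂ W}
    (hT : (T : Set W) ⊆ coneTangentSpace X x) {κ : Type} [Fintype κ]
    (ρ : MvPolynomial (Module.Dual ℂ W) ℂ →ₐ[ℂ] MvPolynomial κ ℂ)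
    (hρ : RingHom.ker ρ ≤ vanishingIdeal X) {d : ℕ} (hd : Module.finrank ℂ T = d + 1)
    (hκ : Fintype.card κ = d + 1) : HasDim X d := by
  refine ringKrullDim_eq_of_trdeg (k := ℂ) (le_antisymm ?_ ?_)
  · rw [← hκ]; exact trdeg_coordinateRing_le ρ hρ
  · rw [← hd]; exact le_trdeg_coordinateRing hT

/-- If `F` is nonzero at `Φ p` and `G` at `Φ q`, restrict both to the image of the line joining p
and q: they become nonzero polynomials in one variable, hence so is their product. -/
theorem isPrime_vanishingIdeal_zariskiClosure {S : Set (ℙ ℂ W)} {P : Type*} [AddCommGroup P]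
    [Module ℂ P] (Φ : P → W) (hS : ∀ w, w ∈ cone S ↔ ∃ p, Φ p = w)
    (hΦ : ∀ p q : P, ∃ (m : ℕ) (w : ℕ → W), ∀ t : ℂ,
      Φ (p + t • q) = ∑ i ∈ Finset.range m, t ^ i • w i) :
    (vanishingIdeal (zariskiClosure S)).IsPrime := by
  have hmem : ∀ F, F ∈ vanishingIdeal (zariskiClosure S) ↔ ∀ p, evalAt F (Φ p) = 0 := by
    intro F
    rw [mem_vanishingIdeal_zariskiClosure]
    exact ⟨fun h p ↦ h _ ((hS _).mpr ⟨p, rfl⟩), fun h w hw ↦ by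
      obtain ⟨p, rfl⟩ := (hS w).mp hw; exact h p⟩
  refine ⟨fun htop ↦ ?_, fun {F G} hFG ↦ ?_⟩
  · have h1 := (hmem 1).mp (htop ▸ Submodule.mem_top) 0
    simp [evalAt] at h1
  · by_contra! hcon
    obtain ⟨hF, hG⟩ := hcon
    simp only [hmem, not_forall] at hF hG hFG
    obtain ⟨p, hp⟩ := hF
    obtain ⟨q, hq⟩ := hG
    obtain ⟨m, w, hw⟩ := hΦ p (q - p)
    obtain ⟨f, hf⟩ := exists_polynomial_evalAt_curve F m w
    obtain ⟨g, hg⟩ := exists_polynomial_evalAt_curve G m w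
    have hfg : f * g = 0 := Polynomial.funext fun t ↦ by
      have := hFG (p + t • (q - p))
      rw [hw] at this
      rw [Polynomial.eval_mul, ← hf, ← hg, Polynomial.eval_zero, ← this]
      simp [evalAt]
    rcases mul_eq_zero.mp hfg with h0 | h0
    · apply hp
      have := hf 0
      rw [← hw, h0] at this
      simpa using this
    · apply hq
      have := hg 1
      rw [← hw, h0] at this
      simpa using this

/-- If a square matrix of linear forms is singular on the cone over `X`, and at `x` it is the
identity bordered by zeros, then its corner entry vanishes on the tangent vectors at `x`. -/
theorem corner_eq_zero_of_mem_coneTangentSpace {X : Set (ℙ ℂ W)} {x v : W}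
    (hv : v ∈ coneTangentSpace X x) {r : ℕ}
    (M : Fin r ⊕ Unit → Fin r ⊕ Unit → Module.Dual ℂ W)
    (hM : ∀ w ∈ cone X, (Matrix.of fun i j ↦ M i j w).det = 0)
    (h11 : ∀ i j, M (.inl i) (.inl j) x = if i = j then 1 else 0)
    (h12 : ∀ i, M i (.inr ()) x = 0) (h21 : ∀ j, M (.inr ()) (.inl j) x = 0) :
    M (.inr ()) (.inr ()) v = 0 := by
  obtain ⟨γ, h0, hX, hd⟩ := hv
  -- The last column vanishes at t = 0, so it may be divided by t; its limit consists of the values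
  -- at `v`. The determinant stays zero for t ≠ 0, and the limit matrix is block triangular with an
  -- identity block.
  let N : ℂ → Matrix (Fin r ⊕ Unit) (Fin r ⊕ Unit) ℂ := fun t ↦ Matrix.of fun i j ↦
    M i j (γ t) * (if j = .inr () then t⁻¹ else 1)
  let L : Matrix (Fin r ⊕ Unit) (Fin r ⊕ Unit) ℂ := Matrix.of fun i j ↦
    if j = .inr () then M i j v else M i j x
  have hlim : Tendsto N (𝓝[≠] 0) (𝓝 L) := by
    refine tendsto_pi_nhds.mpr fun i ↦ tendsto_pi_nhds.mpr fun j ↦ ?_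
    rcases j with j | j
    · have : Tendsto (fun t ↦ M i (.inl j) (γ t)) (𝓝 0) (𝓝 (M i (.inl j) (γ 0))) :=
        (hd _).2.continuousAt
      simpa [N, L, h0] using this.mono_left nhdsWithin_le_nhds
    · have := hasDerivAt_iff_tendsto_slope_zero.mp (hd (M i (.inr ()))).2
      simpa [N, L, h0, h12, mul_comm] using this
  have hdet : Tendsto (fun t ↦ (N t).det) (𝓝[≠] 0) (𝓝 L.det) :=
    ((Continuous.matrix_det continuous_id).tendsto L).comp hlim
  have hzero : L.det = 0 := by
    refine tendsto_nhds_unique hdet (tendsto_const_nhds.congr' ?_)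
    filter_upwards [hX.filter_mono nhdsWithin_le_nhds] with t ht
    have h1 := Matrix.det_mul_row (fun j : Fin r ⊕ Unit ↦ if j = .inr () then t⁻¹ else 1)
      (Matrix.of fun i j ↦ M i j (γ t))
    rw [hM _ ht, mul_zero] at h1
    rw [← h1]
    congr 1
    ext i j
    simp [N, mul_comm]
  have hL : L = Matrix.fromBlocks 1 (Matrix.of fun i _ ↦ M (.inl i) (.inr ()) v) 0
      (Matrix.of fun _ _ ↦ M (.inr ()) (.inr ()) v) := by
    ext i j
    rcases i with i | i <;> rcases j with j | j <;>
      simp [L, h11, h21, Matrix.one_apply]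
  rw [hL, Matrix.det_fromBlocks_zero₂₁] at hzero
  simpa using hzero

end Tangent

/-! ## Trivectors -/

section Trivector

variable {V : Type*} [AddCommGroup V] [Module ℂ V] {U : Type*} [AddCommGroup U] [Module ℂ U]

/-- The product `a ∧ b ∧ c` in `⋀³ V`. -/
def w3 (a b c : V) : ⋀[ℂ]^3 V := exteriorPower.ιMulti ℂ 3 ![a, b, c]

theorem w3_add₁ (a a' b c : V) : w3 (a + a') b c = w3 a b c + w3 a' b c :=
  (exteriorPower.ιMulti ℂ 3).toMultilinearMap.cons_add ![b, c] a a'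

theorem w3_smul₁ (t : ℂ) (a b c : V) : w3 (t • a) b c = t • w3 a b c :=
  (exteriorPower.ιMulti ℂ 3).toMultilinearMap.cons_smul ![b, c] t a

theorem w3_swap₁₂ (a b c : V) : w3 b a c = -w3 a b c := by
  have := (exteriorPower.ιMulti ℂ 3).map_swap ![a, b, c] (i := 0) (j := 1) (by decide)
  rw [w3, w3, ← this]
  congr 1
  ext i; fin_cases i <;> rfl

theorem w3_swap₂₃ (a b c : V) : w3 a c b = -w3 a b c := by
  have := (exteriorPower.ιMulti ℂ 3).map_swap ![a, b, c] (i := 1) (j := 2) (by decide)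
  rw [w3, w3, ← this]
  congr 1
  ext i; fin_cases i <;> rfl

theorem w3_rotate (a b c : V) : w3 b c a = w3 a b c := by
  rw [w3_swap₂₃, w3_swap₁₂, neg_neg]

theorem w3_add₂ (a b b' c : V) : w3 a (b + b') c = w3 a b c + w3 a b' c := by
  rw [w3_swap₁₂, w3_add₁, neg_add, ← w3_swap₁₂, ← w3_swap₁₂]

theorem w3_smul₂ (t : ℂ) (a b c : V) : w3 a (t • b) c = t • w3 a b c := by
  rw [← w3_rotate, w3_smul₁, w3_rotate]

theorem w3_add₃ (a b c c' : V) : w3 a b (c + c') = w3 a b c + w3 a b c' := by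
  rw [w3_swap₂₃, w3_add₂, neg_add, ← w3_swap₂₃, ← w3_swap₂₃]

theorem w3_smul₃ (t : ℂ) (a b c : V) : w3 a b (t • c) = t • w3 a b c := by
  rw [← w3_rotate a, w3_smul₂, w3_rotate]

theorem w3_self₁₂ (a c : V) : w3 a a c = 0 :=
  (exteriorPower.ιMulti ℂ 3).map_eq_zero_of_eq ![a, a, c] (i := 0) (j := 1) rfl (by decide)

theorem w3_self₂₃ (a b : V) : w3 a b b = 0 :=
  (exteriorPower.ιMulti ℂ 3).map_eq_zero_of_eq ![a, b, b] (i := 1) (j := 2) rfl (by decide)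

theorem w3_self₁₃ (a b : V) : w3 a b a = 0 :=
  (exteriorPower.ιMulti ℂ 3).map_eq_zero_of_eq ![a, b, a] (i := 0) (j := 2) rfl (by decide)

theorem w3_zero₁ (b c : V) : w3 0 b c = 0 := by simpa using w3_smul₁ 0 0 b c

theorem w3_neg_middle (a b c : V) : w3 a (-b) c = w3 b a c := by
  rw [w3_swap₁₂ a b, eq_neg_iff_add_eq_zero, ← w3_add₂, neg_add_cancel]
  exact (exteriorPower.ιMulti ℂ 3).map_coord_zero 1 rfl

theorem ιMulti_eq_w3 (v : Fin 3 → V) : exteriorPower.ιMulti ℂ 3 v = w3 (v 0) (v 1) (v 2) := by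
  rw [w3]; congr 1; ext i; fin_cases i <;> rfl

theorem map_w3 (g : U →ₗ[ℂ] V) (a b c : U) :
    exteriorPower.map 3 g (w3 a b c) = w3 (g a) (g b) (g c) := by
  rw [w3, exteriorPower.map_apply_ιMulti, ιMulti_eq_w3]; rfl

theorem coe_w3 (a b c : V) : (w3 a b c : ExteriorAlgebra ℂ V) =
    ExteriorAlgebra.ι ℂ a * (ExteriorAlgebra.ι ℂ b * ExteriorAlgebra.ι ℂ c) := by
  rw [w3, exteriorPower.ιMulti_apply_coe, ExteriorAlgebra.ιMulti_apply]
  simp [List.ofFn_succ]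

theorem trivector_induction {p : ⋀[ℂ]^3 V → Prop} (h : ∀ a b c, p (w3 a b c))
    (hz : p 0) (ha : ∀ x y, p x → p y → p (x + y)) (hs : ∀ (t : ℂ) x, p x → p (t • x))
    (x : ⋀[ℂ]^3 V) : p x := by
  have hx : x ∈ Submodule.span ℂ (Set.range (exteriorPower.ιMulti ℂ 3 (M := V))) := by
    rw [exteriorPower.ιMulti_span]; trivial
  induction hx using Submodule.span_induction with
  | mem x hx => obtain ⟨v, rfl⟩ := hx; rw [ιMulti_eq_w3]; exact h _ _ _
  | zero => exact hz
  | add x y _ _ hx hy => exact ha x y hx hy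
  | smul t x _ hx => exact hs t x hx

/-! ### Contractions of trivectors and the rank equations -/

/-- The linear form on `⋀³ V` given by three linear forms on `V`. -/
def tri (φ ψ χ : Module.Dual ℂ V) : Module.Dual ℂ (⋀[ℂ]^3 V) :=
  exteriorPower.pairingDual ℂ V 3 (w3 φ ψ χ)

theorem tri_w3 (φ ψ χ : Module.Dual ℂ V) (a b c : V) :
    tri φ ψ χ (w3 a b c) = φ a * (ψ b * χ c - ψ c * χ b) - φ b * (ψ a * χ c - ψ c * χ a)
      + φ c * (ψ a * χ b - ψ b * χ a) := by
  rw [tri, w3, w3, exteriorPower.pairingDual_ιMulti_ιMulti, Matrix.det_fin_three]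
  simp
  ring

theorem tri_map (φ ψ χ : Module.Dual ℂ V) (g : U →ₗ[ℂ] V) (x : ⋀[ℂ]^3 U) :
    tri φ ψ χ (exteriorPower.map 3 g x) = tri (φ ∘ₗ g) (ψ ∘ₗ g) (χ ∘ₗ g) x := by
  induction x using trivector_induction with
  | h a b c => simp [map_w3, tri_w3]
  | hz => simp
  | ha x y hx hy => simp [hx, hy]
  | hs t x hx => simp [hx]

/-- The linear form of `tri` as a linear function of its first argument. -/
def triL (ψ χ : Module.Dual ℂ V) : Module.Dual ℂ V →ₗ[ℂ] Module.Dual ℂ (⋀[ℂ]^3 V) where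
  toFun φ := tri φ ψ χ
  map_add' φ φ' := by rw [tri, w3_add₁, map_add]; rfl
  map_smul' t φ := by rw [tri, w3_smul₁, map_smul]; rfl

theorem triL_apply (φ ψ χ : Module.Dual ℂ V) : triL ψ χ φ = tri φ ψ χ := rfl

/-- A linear form on `⋀³ V` depending linearly on a linear form `φ` on `V`, in such a way that
its value at the image of a trivector under `g : U → V` depends on `φ ∘ g` only. -/
def IsContraction (B : Module.Dual ℂ V →ₗ[ℂ] Module.Dual ℂ (⋀[ℂ]^3 V)) : Prop :=
  ∀ (r : ℕ) (g : (Fin r → ℂ) →ₗ[ℂ] V) (φ : Module.Dual ℂ V), φ ∘ₗ g = 0 →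
    ∀ x, B φ (exteriorPower.map 3 g x) = 0

theorem isContraction_triL (ψ χ : Module.Dual ℂ V) : IsContraction (triL ψ χ) := by
  intro r g φ h x
  rw [triL_apply, tri_map, h, tri, w3_zero₁]
  simp

theorem IsContraction.sub {B B' : Module.Dual ℂ V →ₗ[ℂ] Module.Dual ℂ (⋀[ℂ]^3 V)}
    (h : IsContraction B) (h' : IsContraction B') : IsContraction (B - B') := by
  intro r g φ hφ x
  simp [h r g φ hφ x, h' r g φ hφ x]

/-- The r + 1 forms `φ i ∘ g` live on `ℂ^r`, so they are dependent; the same coefficients give a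
left null vector of the matrix. -/
theorem det_contraction_eq_zero {r : ℕ} (φ : Fin r ⊕ Unit → Module.Dual ℂ V)
    (B : Fin r ⊕ Unit → (Module.Dual ℂ V →ₗ[ℂ] Module.Dual ℂ (⋀[ℂ]^3 V)))
    (hB : ∀ j, IsContraction (B j)) (g : (Fin r → ℂ) →ₗ[ℂ] V) (x : ⋀[ℂ]^3 (Fin r → ℂ)) :
    (Matrix.of fun i j ↦ B j (φ i) (exteriorPower.map 3 g x)).det = 0 := by
  have hdep : ¬ LinearIndependent ℂ fun i ↦ (φ i ∘ₗ g : Module.Dual ℂ (Fin r → ℂ)) := by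
    intro h
    have := h.fintype_card_le_finrank
    rw [Subspace.dual_finrank_eq] at this
    simp at this
  obtain ⟨c, hc, i, hi⟩ := Fintype.not_linearIndependent_iff.mp hdep
  refine Matrix.exists_vecMul_eq_zero_iff.mp ⟨c, fun h0 ↦ hi (congrFun h0 i), ?_⟩
  ext j
  have hφ : (∑ i, c i • φ i) ∘ₗ g = 0 := by
    rw [← hc]; ext; simp
  have := hB j r g _ hφ x
  simpa [Matrix.vecMul, dotProduct] using this

/-- The tangent equations coming from the rank of the contraction. -/
theorem contraction_eq_zero_of_mem_coneTangentSpace {S : Set (ℙ ℂ (⋀[ℂ]^3 V))} {r : ℕ}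
    {x v : ⋀[ℂ]^3 V} (hv : v ∈ coneTangentSpace (zariskiClosure S) x)
    (hS : ∀ w ∈ cone S, ∃ (g : (Fin r → ℂ) →ₗ[ℂ] V) (y : ⋀[ℂ]^3 (Fin r → ℂ)),
      w = exteriorPower.map 3 g y)
    (φ : Fin r → Module.Dual ℂ V) (φ₀ : Module.Dual ℂ V)
    (B : Fin r → (Module.Dual ℂ V →ₗ[ℂ] Module.Dual ℂ (⋀[ℂ]^3 V)))
    (B₀ : Module.Dual ℂ V →ₗ[ℂ] Module.Dual ℂ (⋀[ℂ]^3 V))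
    (hB : ∀ j, IsContraction (B j)) (hB₀ : IsContraction B₀)
    (h11 : ∀ i j, B j (φ i) x = if i = j then 1 else 0) (h12 : ∀ i, B₀ (φ i) x = 0)
    (h21 : ∀ j, B j φ₀ x = 0) (h22 : B₀ φ₀ x = 0) : B₀ φ₀ v = 0 := by
  refine corner_eq_zero_of_mem_coneTangentSpace hv
    (fun i j ↦ (Sum.elim B (fun _ ↦ B₀) j) (Sum.elim φ (fun _ ↦ φ₀) i)) (fun w hw ↦ ?_)
    h11 ?_ h21
  rotate_left
  · rintro (i | i)
    exacts [h12 i, h22]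
  -- The minor is realized as a polynomial so that its vanishing passes from `cone S` to the
  -- closure.
  let F : MvPolynomial (Module.Dual ℂ (⋀[ℂ]^3 V)) ℂ := (Matrix.of fun i j : Fin r ⊕ Unit ↦
    MvPolynomial.X ((Sum.elim B (fun _ ↦ B₀) j) (Sum.elim φ (fun _ ↦ φ₀) i))).det
  have hF : ∀ w, evalAt F w = (Matrix.of fun i j : Fin r ⊕ Unit ↦
      (Sum.elim B (fun _ ↦ B₀) j) (Sum.elim φ (fun _ ↦ φ₀) i) w).det := by
    intro w
    rw [evalAt, RingHom.map_det]
    congr 1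
    ext i j
    simp
  rw [← hF]
  refine evalAt_eq_zero_of_mem_cone_zariskiClosure (fun u hu ↦ ?_) hw
  obtain ⟨g, y, rfl⟩ := hS u hu
  rw [hF]
  exact det_contraction_eq_zero _ _ (by rintro (j | j); exacts [hB j, hB₀]) g y

/-- `⋀³` of a linear map is cubic in the map, hence four coefficients along a line of maps. -/
theorem exists_map_add_smul_eq (g h : U →ₗ[ℂ] V) (x : ⋀[ℂ]^3 U) :
    ∃ w : ℕ → ⋀[ℂ]^3 V, ∀ t : ℂ,
      exteriorPower.map 3 (g + t • h) x = ∑ i ∈ Finset.range 4, t ^ i • w i := by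
  induction x using trivector_induction with
  | h a b c =>
    refine ⟨fun i ↦ match i with
      | 0 => w3 (g a) (g b) (g c)
      | 1 => w3 (h a) (g b) (g c) + w3 (g a) (h b) (g c) + w3 (g a) (g b) (h c)
      | 2 => w3 (h a) (h b) (g c) + w3 (h a) (g b) (h c) + w3 (g a) (h b) (h c)
      | _ => w3 (h a) (h b) (h c), fun t ↦ ?_⟩
    simp only [map_w3, LinearMap.add_apply, LinearMap.smul_apply, w3_add₁, w3_add₂, w3_add₃,
      w3_smul₁, w3_smul₂, w3_smul₃, Finset.sum_range_succ, Finset.sum_range_zero]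
    module
  | hz => exact ⟨fun _ ↦ 0, by simp⟩
  | ha x y hx hy =>
    obtain ⟨w, hw⟩ := hx
    obtain ⟨w', hw'⟩ := hy
    exact ⟨w + w', fun t ↦ by simp [hw, hw', Finset.sum_add_distrib]⟩
  | hs s x hx =>
    obtain ⟨w, hw⟩ := hx
    exact ⟨s • w, fun t ↦ by simp [hw, Finset.smul_sum, smul_comm s]⟩

attribute [irreducible] w3 tri

/-! ## Cones over the Grassmannian and over the sets of secant points -/

/-- The third exterior power of a 3-space is a line, and the determinant of the basis shows that the
product of its vectors is nonzero. -/
theorem exists_eq_smul_w3_of_basis {E : Type*} [AddCommGroup E] [Module ℂ E]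
    (b : Module.Basis (Fin 3) ℂ E) (x : ⋀[ℂ]^3 E) : ∃ c : ℂ, c • w3 (b 0) (b 1) (b 2) = x := by
  have : FiniteDimensional ℂ E := Module.Basis.finiteDimensional_of_finite b
  have h1 : Module.finrank ℂ (⋀[ℂ]^3 E) = 1 := by
    rw [exteriorPower.finrank_eq, Module.finrank_eq_card_basis b]; rfl
  have h0 : exteriorPower.ιMulti ℂ 3 b ≠ 0 := by
    intro h
    have h2 := exteriorPower.alternatingMapLinearEquiv_apply_ιMulti b.det b
    rw [h, b.det_self, map_zero] at h2
    exact zero_ne_one h2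
  rw [← ιMulti_eq_w3]
  exact (finrank_eq_one_iff_of_nonzero' _ h0).mp h1 x

theorem exists_basis_of_ne_zero {E : Type*} [AddCommGroup E] [Module ℂ E]
    (hE : Module.finrank ℂ E = 3) {u : E} (hu : u ≠ 0) :
    ∃ b : Module.Basis (Fin 3) ℂ E, b 0 = u := by
  have : FiniteDimensional ℂ E := FiniteDimensional.of_finrank_pos (by omega)
  have h1 : LinearIndependent ℂ ![u] := .of_subsingleton (v := ![u]) 0 hu
  obtain ⟨a, h2⟩ := exists_linearIndependent_snoc_of_lt_finrank h1 (by omega)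
  obtain ⟨b, h3⟩ := exists_linearIndependent_snoc_of_lt_finrank h2 (by omega)
  refine ⟨basisOfLinearIndependentOfCardEqFinrank h3 (by simp [hE]), ?_⟩
  rw [coe_basisOfLinearIndependentOfCardEqFinrank]
  rfl

/-- Complete `u` to a basis of `E` and absorb the scalar into another factor. Choosing `u` freely
lets two meeting planes share a first factor. -/
theorem exists_eq_w3_of_mem_pluckerLine {E : Submodule ℂ V} (hE : Module.finrank ℂ E = 3)
    {w : ⋀[ℂ]^3 V} (hw : w ∈ pluckerLine 3 E) {u : V} (hu : u ∈ E) (hu0 : u ≠ 0) :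
    ∃ a b, w = w3 u a b := by
  obtain ⟨x, rfl⟩ := hw
  obtain ⟨b, hb⟩ := exists_basis_of_ne_zero hE (u := ⟨u, hu⟩) (by simpa using hu0)
  obtain ⟨c, rfl⟩ := exists_eq_smul_w3_of_basis b x
  refine ⟨c • (b 1 : V), (b 2 : V), ?_⟩
  rw [map_smul, map_w3, hb, w3_smul₂]
  rfl

theorem exists_mem_ne_zero_of_finrank {E : Submodule ℂ V} (hE : 1 ≤ Module.finrank ℂ E) :
    ∃ u ∈ E, u ≠ 0 := by
  have : Nontrivial E := Module.nontrivial_of_finrank_pos (R := ℂ) (by omega)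
  obtain ⟨u, hu⟩ := exists_ne (0 : E)
  exact ⟨u, u.2, by simpa using hu⟩

/-- The membership `a ∈ E` is recorded so that two products with the same first factor yield planes
that visibly meet. -/
theorem exists_submodule_of_w3_ne_zero {a b c : V} (h : w3 a b c ≠ 0) :
    ∃ E : Submodule ℂ V, Module.finrank ℂ E = 3 ∧ a ∈ E ∧
      Submodule.span ℂ {w3 a b c} = pluckerLine 3 E := by
  have hli : LinearIndependent ℂ ![a, b, c] := by
    by_contra hcon
    exact h (by rw [w3]; exact AlternatingMap.map_linearDependent _ _ hcon)
  let B := Module.Basis.span hli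
  refine ⟨Submodule.span ℂ (Set.range ![a, b, c]), by
    rw [finrank_span_eq_card hli]; rfl, Submodule.subset_span ⟨0, rfl⟩, ?_⟩
  have hB : exteriorPower.map 3 (Submodule.subtype _) (w3 (B 0) (B 1) (B 2)) = w3 a b c := by
    rw [map_w3]
    simp [B, Module.Basis.span_apply]
  apply le_antisymm
  · rw [Submodule.span_singleton_le_iff_mem]
    exact ⟨_, hB⟩
  · rintro _ ⟨x, rfl⟩
    obtain ⟨t, rfl⟩ := exists_eq_smul_w3_of_basis B x
    rw [map_smul, hB]
    exact Submodule.smul_mem _ _ (Submodule.mem_span_singleton_self _)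

theorem mem_cone_grassmannian {w : ⋀[ℂ]^3 V} :
    w ∈ cone (grassmannian V 3) ↔ ∃ a b c, w = w3 a b c := by
  constructor
  · intro h
    by_cases hw : w = 0
    · exact ⟨0, 0, 0, by rw [hw, w3_zero₁]⟩
    · obtain ⟨E, hE, hEw⟩ := h hw
      rw [Projectivization.submodule_mk] at hEw
      obtain ⟨u, hu, hu0⟩ := exists_mem_ne_zero_of_finrank (E := E) (by omega)
      obtain ⟨a, b, h⟩ := exists_eq_w3_of_mem_pluckerLine hE
        (hEw ▸ Submodule.mem_span_singleton_self w) hu hu0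
      exact ⟨u, a, b, h⟩
  · rintro ⟨a, b, c, rfl⟩ hw
    obtain ⟨E, hE, -, hEw⟩ := exists_submodule_of_w3_ne_zero hw
    exact ⟨E, hE, by rw [Projectivization.submodule_mk, hEw]⟩

variable (V) in
/-- The points on lines spanned by two planes meeting in dimension at least one. -/
def meetingSecantPoints : Set (ℙ ℂ (⋀[ℂ]^3 V)) :=
  {p | ∃ E : Fin 2 → Submodule ℂ V, (∀ i, Module.finrank ℂ (E i) = 3) ∧
    1 ≤ Module.finrank ℂ (⨅ i, E i : Submodule ℂ V) ∧ p.submodule ≤ ⨆ i, pluckerLine 3 (E i)}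

variable (V) in
/-- The points on lines spanned by two points of the Grassmannian. -/
def secantPoints : Set (ℙ ℂ (⋀[ℂ]^3 V)) :=
  {p | ∃ x : Fin 2 → ℙ ℂ (⋀[ℂ]^3 V), (∀ i, x i ∈ grassmannian V 3) ∧
    p.submodule ≤ ⨆ i, (x i).submodule}

theorem restrictedSecant_eq : restrictedSecant V 2 1 3 = zariskiClosure (meetingSecantPoints V) :=
  rfl

theorem secantVariety_eq :
    secantVariety 2 (grassmannian V 3) = zariskiClosure (secantPoints V) := rfl

theorem iSup_fin_two_eq {α : Type*} [CompleteLattice α] (f : Fin 2 → α) : ⨆ i, f i = f 0 ⊔ f 1 := by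
  apply le_antisymm
  · refine iSup_le fun i ↦ ?_
    fin_cases i
    exacts [le_sup_left, le_sup_right]
  · exact sup_le (le_iSup f 0) (le_iSup f 1)

theorem iInf_fin_two_eq {α : Type*} [CompleteLattice α] (f : Fin 2 → α) : ⨅ i, f i = f 0 ⊓ f 1 :=
  iSup_fin_two_eq (α := αᵒᵈ) f

theorem mk_mem_meetingSecantPoints {x y : ⋀[ℂ]^3 V} {E E' : Submodule ℂ V} {u : V}
    (hxy : x + y ≠ 0) (hE : Module.finrank ℂ E = 3) (hE' : Module.finrank ℂ E' = 3)
    (hu : u ∈ E) (hu' : u ∈ E') (hu0 : u ≠ 0) (hx : x ∈ pluckerLine 3 E)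
    (hy : y ∈ pluckerLine 3 E') :
    Projectivization.mk ℂ (x + y) hxy ∈ meetingSecantPoints V := by
  refine ⟨![E, E'], Fin.forall_fin_two.mpr ⟨hE, hE'⟩, ?_, ?_⟩
  · rw [iInf_fin_two_eq]
    have : FiniteDimensional ℂ E := FiniteDimensional.of_finrank_pos (by omega)
    have : FiniteDimensional ℂ (E ⊓ E' : Submodule ℂ V) :=
      Submodule.finiteDimensional_of_le inf_le_left
    have : Nontrivial (E ⊓ E' : Submodule ℂ V) := ⟨⟨u, hu, hu'⟩, 0, fun h ↦ hu0 (congrArg Subtype.val h)⟩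
    exact Module.finrank_pos (R := ℂ) (M := (E ⊓ E' : Submodule ℂ V))
  · rw [Projectivization.submodule_mk, iSup_fin_two_eq, Submodule.span_singleton_le_iff_mem]
    simp only [Matrix.cons_val_zero, Matrix.cons_val_one]
    exact Submodule.add_mem_sup hx hy

theorem mem_cone_meetingSecantPoints {w : ⋀[ℂ]^3 V} :
    w ∈ cone (meetingSecantPoints V) ↔ ∃ u a b c d, w = w3 u a b + w3 u c d := by
  constructor
  · intro h
    by_cases hw : w = 0
    · exact ⟨0, 0, 0, 0, 0, by rw [hw, w3_zero₁, add_zero]⟩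
    · obtain ⟨E, hE, h1, hEw⟩ := h hw
      rw [Projectivization.submodule_mk, iSup_fin_two_eq, Submodule.span_singleton_le_iff_mem,
        Submodule.mem_sup] at hEw
      obtain ⟨x, hx, y, hy, rfl⟩ := hEw
      obtain ⟨u, hu, hu0⟩ := exists_mem_ne_zero_of_finrank h1
      rw [Submodule.mem_iInf] at hu
      obtain ⟨a, b, rfl⟩ := exists_eq_w3_of_mem_pluckerLine (hE 0) hx (hu 0) hu0
      obtain ⟨c, d, rfl⟩ := exists_eq_w3_of_mem_pluckerLine (hE 1) hy (hu 1) hu0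
      exact ⟨u, a, b, c, d, rfl⟩
  · rintro ⟨u, a, b, c, d, rfl⟩ hw
    have hu0 : u ≠ 0 := by
      rintro rfl; simp [w3_zero₁] at hw
    -- A zero product determines no plane; the plane of the other product is then taken twice.
    by_cases h1 : w3 u a b = 0
    · have h2 : w3 u c d ≠ 0 := fun h2 ↦ hw (by rw [h1, h2, add_zero])
      obtain ⟨E, hE, hu, hEw⟩ := exists_submodule_of_w3_ne_zero h2
      exact mk_mem_meetingSecantPoints hw hE hE hu hu hu0 (h1 ▸ zero_mem _) (hEw ▸ Submodule.mem_span_singleton_self _)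
    · obtain ⟨E, hE, hu, hEw⟩ := exists_submodule_of_w3_ne_zero h1
      by_cases h2 : w3 u c d = 0
      · exact mk_mem_meetingSecantPoints hw hE hE hu hu hu0 (hEw ▸ Submodule.mem_span_singleton_self _) (h2 ▸ zero_mem _)
      · obtain ⟨E', hE', hu', hEw'⟩ := exists_submodule_of_w3_ne_zero h2
        exact mk_mem_meetingSecantPoints hw hE hE' hu hu' hu0 (hEw ▸ Submodule.mem_span_singleton_self _)
          (hEw' ▸ Submodule.mem_span_singleton_self _)

theorem mem_cone_secantPoints {w : ⋀[ℂ]^3 V} :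
    w ∈ cone (secantPoints V) ↔ ∃ a b c a' b' c', w = w3 a b c + w3 a' b' c' := by
  have hmem : ∀ {p : ℙ ℂ (⋀[ℂ]^3 V)}, p ∈ grassmannian V 3 → ∀ {x}, x ∈ p.submodule →
      ∃ a b c, x = w3 a b c := by
    rintro p ⟨E, hE, hp⟩ x hx
    rw [hp] at hx
    obtain ⟨u, hu, hu0⟩ := exists_mem_ne_zero_of_finrank (E := E) (by omega)
    obtain ⟨a, b, h⟩ := exists_eq_w3_of_mem_pluckerLine hE hx hu hu0
    exact ⟨u, a, b, h⟩
  constructor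
  · intro h
    by_cases hw : w = 0
    · exact ⟨0, 0, 0, 0, 0, 0, by rw [hw, w3_zero₁, add_zero]⟩
    · obtain ⟨x, hx, hw'⟩ := h hw
      rw [Projectivization.submodule_mk, iSup_fin_two_eq, Submodule.span_singleton_le_iff_mem,
        Submodule.mem_sup] at hw'
      obtain ⟨y, hy, z, hz, rfl⟩ := hw'
      obtain ⟨a, b, c, rfl⟩ := hmem (hx 0) hy
      obtain ⟨a', b', c', rfl⟩ := hmem (hx 1) hz
      exact ⟨a, b, c, a', b', c', rfl⟩
  · rintro ⟨a, b, c, a', b', c', rfl⟩ hw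
    have key : ∀ {x y : ⋀[ℂ]^3 V} {p q : ℙ ℂ (⋀[ℂ]^3 V)} (hxy : x + y ≠ 0),
        p ∈ grassmannian V 3 → q ∈ grassmannian V 3 → x ∈ p.submodule → y ∈ q.submodule →
        Projectivization.mk ℂ (x + y) hxy ∈ secantPoints V := by
      intro x y p q hxy hp hq hx hy
      refine ⟨![p, q], Fin.forall_fin_two.mpr ⟨hp, hq⟩, ?_⟩
      rw [Projectivization.submodule_mk, iSup_fin_two_eq, Submodule.span_singleton_le_iff_mem]
      exact Submodule.add_mem_sup hx hy
    have hself : ∀ {x : ⋀[ℂ]^3 V} (hx : x ≠ 0), x ∈ (Projectivization.mk ℂ x hx).submodule :=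
      fun hx ↦ by rw [Projectivization.submodule_mk]; exact Submodule.mem_span_singleton_self _
    have hg : ∀ {a b c : V} (h : w3 a b c ≠ 0),
        Projectivization.mk ℂ _ h ∈ grassmannian V 3 :=
      fun h ↦ mem_cone_grassmannian.mpr ⟨_, _, _, rfl⟩ h
    by_cases h1 : w3 a b c = 0
    · have h2 : w3 a' b' c' ≠ 0 := fun h2 ↦ hw (by rw [h1, h2, add_zero])
      exact key hw (hg h2) (hg h2) (h1 ▸ zero_mem _) (hself h2)
    · by_cases h2 : w3 a' b' c' = 0
      · exact key hw (hg h1) (hg h1) (hself h1) (h2 ▸ zero_mem _)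
      · exact key hw (hg h1) (hg h2) (hself h1) (hself h2)

end Trivector

/-! ## Coordinates -/

section Coordinates

variable {V : Type*} [AddCommGroup V] [Module ℂ V] {n : ℕ} (e : Module.Basis (Fin n) ℂ V)

/-- The coordinate forms dual to `vec e i`. -/
def co (i : ℕ) : Module.Dual ℂ V :=
  if h : 1 ≤ i ∧ i ≤ n then e.coord ⟨i - 1, by omega⟩ else 0

theorem co_vec (i j : ℕ) :
    co e i (vec e j) = if i = j ∧ 1 ≤ i ∧ i ≤ n then 1 else 0 := by
  unfold co vec
  by_cases hi : 1 ≤ i ∧ i ≤ n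
  · by_cases hj : 1 ≤ j ∧ j ≤ n
    · simp only [hi, hj, dif_pos, Module.Basis.coord_apply, Module.Basis.repr_self,
        Finsupp.single_apply, Fin.mk.injEq, and_self, and_true]
      congr 1
      apply propext
      omega
    · have : ¬ (i = j ∧ 1 ≤ i ∧ i ≤ n) := by omega
      simp [hj, this]
  · simp [hi]

theorem co_vec_self {i : ℕ} (h1 : 1 ≤ i) (h2 : i ≤ n) : co e i (vec e i) = 1 := by
  simp [co_vec, h1, h2]

theorem co_vec_ne {i j : ℕ} (h : i ≠ j) : co e i (vec e j) = 0 := by simp [co_vec, h]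

theorem e3_eq_w3 (i j k : ℕ) : e3 e i j k = w3 (vec e i) (vec e j) (vec e k) := by
  rw [e3, w3]

theorem span_vec_eq_top : Submodule.span ℂ {v | ∃ i, 1 ≤ i ∧ i ≤ n ∧ v = vec e i} = ⊤ := by
  rw [eq_top_iff, ← e.span_eq]
  refine Submodule.span_mono ?_
  rintro _ ⟨i, rfl⟩
  exact ⟨i + 1, by omega, by omega, by simp [vec]⟩

theorem w3_mem_of_vec {N : Submodule ℂ (⋀[ℂ]^3 V)} {b c : V}
    (h : ∀ i, 1 ≤ i → i ≤ n → w3 (vec e i) b c ∈ N) (v : V) : w3 v b c ∈ N := by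
  have hv : v ∈ Submodule.span ℂ {v | ∃ i, 1 ≤ i ∧ i ≤ n ∧ v = vec e i} := by
    rw [span_vec_eq_top]; trivial
  induction hv using Submodule.span_induction with
  | mem x hx => obtain ⟨i, h1, h2, rfl⟩ := hx; exact h i h1 h2
  | zero => rw [w3_zero₁]; exact zero_mem _
  | add x y _ _ hx hy => rw [w3_add₁]; exact add_mem hx hy
  | smul t x _ hx => rw [w3_smul₁]; exact N.smul_mem t hx

theorem tri_rotate (φ ψ χ : Module.Dual ℂ V) : tri χ φ ψ = tri φ ψ χ := by
  rw [tri, tri, ← w3_rotate]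

/-- The Plücker coordinates. -/
def tc (i j k : ℕ) : Module.Dual ℂ (⋀[ℂ]^3 V) := tri (co e i) (co e j) (co e k)

theorem tc_e3_of_lt {i j k a b c : ℕ} (hij : i < j) (hjk : j < k) (hab : a < b) (hbc : b < c)
    (hi : 1 ≤ i) (hk : k ≤ n) :
    tc e i j k (e3 e a b c) = if i = a ∧ j = b ∧ k = c then 1 else 0 := by
  rw [tc, e3_eq_w3, tri_w3]
  split_ifs with h
  · obtain ⟨rfl, rfl, rfl⟩ := h
    rw [co_vec_self e (by omega) (by omega), co_vec_self e (by omega) (by omega),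
      co_vec_self e (by omega) (by omega), co_vec_ne e (by omega : i ≠ j),
      co_vec_ne e (by omega : i ≠ k), co_vec_ne e (by omega : j ≠ k)]
    simp
  · simp only [co_vec]
    by_cases h1 : i = a
    · have h2 : i ≠ b := by omega
      have h3 : i ≠ c := by omega
      by_cases h4 : j = b
      · have h5 : j ≠ c := by omega
        have h6 : k ≠ c := by omega
        simp [h2, h3, h5, h6]
      · by_cases h5 : j = c
        · have h7 : k ≠ c := by omega
          have h8 : k ≠ b := by omega
          simp [h2, h3, h4, h7, h8]
        · simp [h2, h3, h4, h5]
    · by_cases h2 : i = b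
      · have h3 : i ≠ c := by omega
        have h4 : j ≠ a := by omega
        have h5 : k ≠ a := by omega
        simp [h1, h3, h4, h5]
      · have h3 : i = c → j ≠ a ∧ k ≠ a ∧ j ≠ b := by omega
        by_cases h4 : i = c
        · simp [h1, h2, h3 h4]
        · simp [h1, h2, h4]

theorem eq_sum_tc_smul_e3 (w : ⋀[ℂ]^3 V) :
    w = ∑ k ∈ Finset.Icc 1 n, ∑ j ∈ Finset.Ico 1 k, ∑ i ∈ Finset.Ico 1 j,
      tc e i j k w • e3 e i j k := by
  have hw : w ∈ Submodule.span ℂ (Set.range (exteriorPower.ιMulti_family ℂ 3 e)) := by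
    rw [exteriorPower.ιMulti_family_span_of_span ℂ e.span_eq]; trivial
  induction hw using Submodule.span_induction with
  | mem x hx =>
    obtain ⟨s, rfl⟩ := hx
    set f := Set.powersetCard.ofFinEmbEquiv.symm s with hf
    have h01 : f 0 < f 1 := f.strictMono (by decide)
    have h12 : f 1 < f 2 := f.strictMono (by decide)
    rw [Fin.lt_def] at h01 h12
    -- `Fin n` counts from 0 and `vec` from 1, whence the shifts.
    have hv : ∀ i : Fin n, e i = vec e (i + 1) := fun i ↦ by simp [vec]
    have hx : exteriorPower.ιMulti_family ℂ 3 e s =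
        e3 e ((f 0 : ℕ) + 1) ((f 1 : ℕ) + 1) ((f 2 : ℕ) + 1) := by
      rw [e3_eq_w3, ← hv, ← hv, ← hv, exteriorPower.ιMulti_family, ιMulti_eq_w3]
      rfl
    have h2 := (f 2).2
    rw [hx]
    obtain ⟨a, b, c, ha, hb, hc⟩ : ∃ a b c, a = (f 0 : ℕ) + 1 ∧ b = (f 1 : ℕ) + 1 ∧
      c = (f 2 : ℕ) + 1 := ⟨_, _, _, rfl, rfl, rfl⟩
    have ha1 : 1 ≤ a := by omega
    have hab : a < b := by omega
    have hbc : b < c := by omega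
    have hcn : c ≤ n := by omega
    rw [← ha, ← hb, ← hc]
    clear ha hb hc hx h2 h01 h12
    have hz : ∀ i j k, i ∈ Finset.Ico 1 j → j ∈ Finset.Ico 1 k → k ∈ Finset.Icc 1 n →
        tc e i j k (e3 e a b c) = if i = a ∧ j = b ∧ k = c then 1 else 0 := by
      intro i j k hi hj hk
      simp only [Finset.mem_Icc, Finset.mem_Ico] at hi hj hk
      exact tc_e3_of_lt e hi.2 hj.2 hab hbc hi.1 hk.2
    have ha : a ∈ Finset.Ico 1 b := by simp [ha1, hab]
    have hb : b ∈ Finset.Ico 1 c := by simp only [Finset.mem_Ico]; omega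
    have hc : c ∈ Finset.Icc 1 n := by simp only [Finset.mem_Icc]; omega
    rw [Finset.sum_eq_single_of_mem c hc, Finset.sum_eq_single_of_mem b hb,
      Finset.sum_eq_single_of_mem a ha, hz a b c ha hb hc]
    · simp
    · intro i hi hne
      rw [hz i b c hi hb hc, if_neg (fun h ↦ hne h.1), zero_smul]
    · intro j hj hne
      refine Finset.sum_eq_zero fun i hi ↦ ?_
      rw [hz i j c hi hj hc, if_neg (fun h ↦ hne h.2.1), zero_smul]
    · intro k hk hne
      refine Finset.sum_eq_zero fun j hj ↦ Finset.sum_eq_zero fun i hi ↦ ?_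
      rw [hz i j k hi hj hk, if_neg (fun h ↦ hne h.2.2), zero_smul]
  | zero => simp
  | add x y _ _ hx hy =>
    conv_lhs => rw [hx, hy]
    simp only [map_add, add_smul, Finset.sum_add_distrib]
  | smul t x _ hx =>
    conv_lhs => rw [hx]
    simp only [map_smul, smul_eq_mul, mul_smul, Finset.smul_sum]

theorem mem_of_forall_tc_smul_mem {N : Submodule ℂ (⋀[ℂ]^3 V)} {w : ⋀[ℂ]^3 V}
    (h : ∀ i j k, 1 ≤ i → i < j → j < k → k ≤ n → tc e i j k w • e3 e i j k ∈ N) : w ∈ N := by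
  rw [eq_sum_tc_smul_e3 e w]
  refine sum_mem fun k hk ↦ sum_mem fun j hj ↦ sum_mem fun i hi ↦ ?_
  simp only [Finset.mem_Icc, Finset.mem_Ico] at hk hj hi
  exact h i j k hi.1 hi.2 hj.2 hk.2

/-- The criterion for subspaces spanned by monomials: each coordinate either vanishes or belongs to
a monomial of `N`. -/
theorem mem_of_forall_tc_eq_zero_or {N : Submodule ℂ (⋀[ℂ]^3 V)} {w : ⋀[ℂ]^3 V}
    (h : ∀ i j k, 1 ≤ i → i < j → j < k → k ≤ n → tc e i j k w = 0 ∨ e3 e i j k ∈ N) : w ∈ N := by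
  refine mem_of_forall_tc_smul_mem e fun i j k h1 h2 h3 h4 ↦ ?_
  rcases h i j k h1 h2 h3 h4 with h | h
  · rw [h, zero_smul]; exact zero_mem _
  · exact N.smul_mem _ h

/-! ## The spaces `V · S` -/

/-- The product `a ∧ b` in `⋀² V`. -/
def w2 (a b : V) : ⋀[ℂ]^2 V := exteriorPower.ιMulti ℂ 2 ![a, b]

theorem e2_eq_w2 (i j : ℕ) : e2 e i j = w2 (vec e i) (vec e j) := rfl

theorem coe_w2 (a b : V) : (w2 a b : ExteriorAlgebra ℂ V) =
    ExteriorAlgebra.ι ℂ a * ExteriorAlgebra.ι ℂ b := by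
  rw [w2, exteriorPower.ιMulti_apply_coe, ExteriorAlgebra.ιMulti_apply]
  simp [List.ofFn_succ]

theorem w3_mem_dot {S : Set (⋀[ℂ]^2 V)} {a b : V} (h : w2 a b ∈ S) (v : V) :
    w3 v a b ∈ dot S :=
  Submodule.subset_span ⟨v, _, h, by rw [coe_w3, coe_w2]⟩

theorem w3_add_w3_mem_dot {S : Set (⋀[ℂ]^2 V)} {a b c d : V} (h : w2 a b + w2 c d ∈ S) (v : V) :
    w3 v a b + w3 v c d ∈ dot S :=
  Submodule.subset_span ⟨v, _, h, by
    rw [Submodule.coe_add, Submodule.coe_add, coe_w3, coe_w3, coe_w2, coe_w2, mul_add]⟩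

theorem dot_le_iff {S : Set (⋀[ℂ]^2 V)} {N : Submodule ℂ (⋀[ℂ]^3 V)} :
    dot S ≤ N ↔ ∀ w ∈ S, ∀ (v : V) (x : ⋀[ℂ]^3 V), (x : ExteriorAlgebra ℂ V) =
      ExteriorAlgebra.ι ℂ v * (w : ExteriorAlgebra ℂ V) → x ∈ N := by
  rw [dot, Submodule.span_le]
  exact ⟨fun h w hw v x hx ↦ h ⟨v, w, hw, hx⟩, fun h x ⟨v, w, hw, hx⟩ ↦ h w hw v x hx⟩

theorem dot_insert (w : ⋀[ℂ]^2 V) (S : Set (⋀[ℂ]^2 V)) : dot (insert w S) = dot {w} ⊔ dot S := by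
  apply le_antisymm
  · rw [dot_le_iff]
    rintro w' (rfl | hw) v x hx
    · exact Submodule.mem_sup_left (Submodule.subset_span ⟨v, _, rfl, hx⟩)
    · exact Submodule.mem_sup_right (Submodule.subset_span ⟨v, _, hw, hx⟩)
  · refine sup_le (Submodule.span_mono ?_) (Submodule.span_mono ?_)
    · rintro x ⟨v, w, rfl, hx⟩; exact ⟨v, _, Or.inl rfl, hx⟩
    · rintro x ⟨v, w, hw, hx⟩; exact ⟨v, _, Or.inr hw, hx⟩

theorem mem_dot_singleton {a b : V} {x : ⋀[ℂ]^3 V} : x ∈ dot {w2 a b} ↔ ∃ v, x = w3 v a b := by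
  constructor
  · intro hx
    induction hx using Submodule.span_induction with
    | mem x hx =>
      obtain ⟨v, w, hw, h⟩ := hx
      rw [Set.mem_singleton_iff.mp hw, coe_w2, ← coe_w3] at h
      exact ⟨v, Subtype.ext h⟩
    | zero => exact ⟨0, by rw [w3_zero₁]⟩
    | add x y _ _ hx hy =>
      obtain ⟨v, rfl⟩ := hx
      obtain ⟨v', rfl⟩ := hy
      exact ⟨v + v', by rw [w3_add₁]⟩
    | smul t x _ hx =>
      obtain ⟨v, rfl⟩ := hx
      exact ⟨t • v, by rw [w3_smul₁]⟩
  · rintro ⟨v, rfl⟩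
    exact w3_mem_dot (Set.mem_singleton _) v

theorem mem_dot_singleton_add {a b c d : V} {x : ⋀[ℂ]^3 V} :
    x ∈ dot {w2 a b + w2 c d} ↔ ∃ v, x = w3 v a b + w3 v c d := by
  constructor
  · intro hx
    induction hx using Submodule.span_induction with
    | mem x hx =>
      obtain ⟨v, w, hw, h⟩ := hx
      rw [Set.mem_singleton_iff.mp hw, Submodule.coe_add, coe_w2, coe_w2, mul_add, ← coe_w3,
        ← coe_w3, ← Submodule.coe_add] at h
      exact ⟨v, Subtype.ext h⟩
    | zero => exact ⟨0, by simp [w3_zero₁]⟩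
    | add x y _ _ hx hy =>
      obtain ⟨v, rfl⟩ := hx
      obtain ⟨v', rfl⟩ := hy
      exact ⟨v + v', by simp only [w3_add₁]; abel⟩
    | smul t x _ hx =>
      obtain ⟨v, rfl⟩ := hx
      exact ⟨t • v, by simp only [w3_smul₁, smul_add]⟩
  · rintro ⟨v, rfl⟩
    exact w3_add_w3_mem_dot (Set.mem_singleton _) v

theorem dot_singleton_le {a b : V} {N : Submodule ℂ (⋀[ℂ]^3 V)} (h : ∀ v, w3 v a b ∈ N) :
    dot {w2 a b} ≤ N := by
  intro x hx
  obtain ⟨v, rfl⟩ := mem_dot_singleton.mp hx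
  exact h v

theorem dot_singleton_add_le {a b c d : V} {N : Submodule ℂ (⋀[ℂ]^3 V)}
    (h : ∀ v, w3 v a b + w3 v c d ∈ N) : dot {w2 a b + w2 c d} ≤ N := by
  intro x hx
  obtain ⟨v, rfl⟩ := mem_dot_singleton_add.mp hx
  exact h v

theorem w3_mem_swap {N : Submodule ℂ (⋀[ℂ]^3 V)} {a b c : V} (h : w3 a b c ∈ N) :
    w3 a c b ∈ N := by
  rw [w3_swap₂₃]; exact neg_mem h

theorem w3_mem_rotate {N : Submodule ℂ (⋀[ℂ]^3 V)} {a b c : V} (h : w3 a b c ∈ N) :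
    w3 b c a ∈ N := by
  rw [w3_rotate]; exact h

theorem w3_mem_middle {N : Submodule ℂ (⋀[ℂ]^3 V)} {a b c : V} (h : w3 a b c ∈ N) :
    w3 b a c ∈ N := by
  rw [w3_swap₁₂]; exact neg_mem h

attribute [irreducible] w2 tc co

/-! ## Tangent vectors along cubic curves -/

/-- Cubic curves suffice, since moving three factors linearly makes a product cubic in t. -/
theorem mem_coneTangentSpace_of_cubic {W : Type*} [AddCommGroup W] [Module ℂ W]
    {X : Set (ℙ ℂ W)} {x v c d : W}
    (h : ∀ t : ℂ, x + t • v + t ^ 2 • c + t ^ 3 • d ∈ cone X) : v ∈ coneTangentSpace X x := by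
  refine ⟨fun t ↦ x + t • v + t ^ 2 • c + t ^ 3 • d, by simp, .of_forall h, fun φ ↦ ⟨?_, ?_⟩⟩
  · simp only [map_add, map_smul, smul_eq_mul]
    fun_prop
  · simp only [map_add, map_smul, smul_eq_mul]
    have h1 := (((hasDerivAt_id (0 : ℂ)).mul_const (φ v)).const_add (φ x)).add
      (((hasDerivAt_pow 2 (0 : ℂ)).mul_const (φ c)).add ((hasDerivAt_pow 3 (0 : ℂ)).mul_const (φ d)))
    convert! h1 using 1
    · ext t; simp [add_assoc]
    · simp

end Coordinates

attribute [local irreducible] e2 e3 dot vec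

/-! ## Images of a fixed trivector -/

section Orbit

variable {V : Type*} [AddCommGroup V] [Module ℂ V]

/-- The standard basis vector of `ℂ^r`. -/
def ε {r : ℕ} (i : Fin r) : Fin r → ℂ := Pi.single i 1

theorem linearCombination_ε {r : ℕ} (v : Fin r → V) (i : Fin r) :
    Fintype.linearCombination ℂ v (ε i) = v i := by
  rw [ε, Fintype.linearCombination_apply_single, one_smul]

/-- The trivector `ε₀ ∧ (ε₁ ∧ ε₂ + ε₃ ∧ ε₄)`. -/
def ξ5 : ⋀[ℂ]^3 (Fin 5 → ℂ) := w3 (ε 0) (ε 1) (ε 2) + w3 (ε 0) (ε 3) (ε 4)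

/-- The trivector `ε₀ ∧ ε₁ ∧ ε₂ + ε₃ ∧ ε₄ ∧ ε₅`. -/
def ξ6 : ⋀[ℂ]^3 (Fin 6 → ℂ) := w3 (ε 0) (ε 1) (ε 2) + w3 (ε 3) (ε 4) (ε 5)

theorem mem_cone_grassmannian_iff_map {w : ⋀[ℂ]^3 V} : w ∈ cone (grassmannian V 3) ↔
    ∃ g : (Fin 3 → ℂ) →ₗ[ℂ] V, exteriorPower.map 3 g (w3 (ε 0) (ε 1) (ε 2)) = w := by
  rw [mem_cone_grassmannian]
  constructor
  · rintro ⟨a, b, c, rfl⟩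
    refine ⟨Fintype.linearCombination ℂ ![a, b, c], ?_⟩
    simp [map_w3, linearCombination_ε]
  · rintro ⟨g, rfl⟩
    exact ⟨_, _, _, map_w3 _ _ _ _⟩

/-- Being an image of one trivector under maps from `ℂ^5` gives the rank bound for the tangent
equations and the parametrization for the dimension. -/
theorem mem_cone_meetingSecantPoints_iff_map {w : ⋀[ℂ]^3 V} :
    w ∈ cone (meetingSecantPoints V) ↔
      ∃ g : (Fin 5 → ℂ) →ₗ[ℂ] V, exteriorPower.map 3 g ξ5 = w := by
  rw [mem_cone_meetingSecantPoints]
  constructor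
  · rintro ⟨u, a, b, c, d, rfl⟩
    refine ⟨Fintype.linearCombination ℂ ![u, a, b, c, d], ?_⟩
    simp [ξ5, map_w3, linearCombination_ε]
  · rintro ⟨g, rfl⟩
    exact ⟨_, _, _, _, _, by rw [ξ5, map_add, map_w3, map_w3]⟩

theorem mem_cone_secantPoints_iff_map {w : ⋀[ℂ]^3 V} :
    w ∈ cone (secantPoints V) ↔
      ∃ g : (Fin 6 → ℂ) →ₗ[ℂ] V, exteriorPower.map 3 g ξ6 = w := by
  rw [mem_cone_secantPoints]
  constructor
  · rintro ⟨a, b, c, a', b', c', rfl⟩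
    refine ⟨Fintype.linearCombination ℂ ![a, b, c, a', b', c'], ?_⟩
    simp [ξ6, map_w3, linearCombination_ε]
  · rintro ⟨g, rfl⟩
    exact ⟨_, _, _, _, _, _, by rw [ξ6, map_add, map_w3, map_w3]⟩

end Orbit

/-! ## The tangent spaces -/

section TangentSpaces

variable {V : Type*} [AddCommGroup V] [Module ℂ V] {n : ℕ} (e : Module.Basis (Fin n) ℂ V)

theorem coneTangentSpace_mono {W : Type*} [AddCommGroup W] [Module ℂ W] {X Y : Set (ℙ ℂ W)}
    (h : X ⊆ Y) (x : W) : coneTangentSpace X x ⊆ coneTangentSpace Y x := by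
  rintro v ⟨γ, h0, hX, hd⟩
  exact ⟨γ, h0, hX.mono fun t ht ↦ cone_mono h ht, hd⟩

/-- The Leibniz rule for (a + tx)(b + ty)(c + tz); the witnesses are its coefficients of t² and t³.
-/
theorem mem_coneTangentSpace_grassmannian (a b c x y z : V) :
    w3 x b c + w3 a y c + w3 a b z ∈ coneTangentSpace (grassmannian V 3) (w3 a b c) := by
  refine mem_coneTangentSpace_of_cubic (c := w3 x y c + w3 x b z + w3 a y z) (d := w3 x y z)
    fun t ↦ mem_cone_grassmannian.mpr ⟨a + t • x, b + t • y, c + t • z, ?_⟩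
  simp only [w3_add₁, w3_add₂, w3_add₃, w3_smul₁, w3_smul₂, w3_smul₃]
  module

theorem mem_coneTangentSpace_restrictedSecant (u a b c d u' a' b' c' d' : V) :
    w3 u' a b + w3 u' c d + w3 u a' b + w3 u a b' + w3 u c' d + w3 u c d' ∈
      coneTangentSpace (restrictedSecant V 2 1 3) (w3 u a b + w3 u c d) := by
  refine mem_coneTangentSpace_of_cubic
    (c := w3 u' a' b + w3 u' a b' + w3 u a' b' + w3 u' c' d + w3 u' c d' + w3 u c' d')
    (d := w3 u' a' b' + w3 u' c' d') fun t ↦ ?_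
  rw [restrictedSecant_eq]
  refine cone_mono (subset_zariskiClosure _) (mem_cone_meetingSecantPoints.mpr
    ⟨u + t • u', a + t • a', b + t • b', c + t • c', d + t • d', ?_⟩)
  simp only [w3_add₁, w3_add₂, w3_add₃, w3_smul₁, w3_smul₂, w3_smul₃]
  module

theorem mem_coneTangentSpace_secantVariety (a b c d f g a' b' c' d' f' g' : V) :
    w3 a' b c + w3 a b' c + w3 a b c' + (w3 d' f g + w3 d f' g + w3 d f g') ∈
      coneTangentSpace (secantVariety 2 (grassmannian V 3)) (w3 a b c + w3 d f g) := by
  refine mem_coneTangentSpace_of_cubic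
    (c := w3 a' b' c + w3 a' b c' + w3 a b' c' + w3 d' f' g + w3 d' f g' + w3 d f' g')
    (d := w3 a' b' c' + w3 d' f' g') fun t ↦ ?_
  rw [secantVariety_eq]
  refine cone_mono (subset_zariskiClosure _) (mem_cone_secantPoints.mpr
    ⟨a + t • a', b + t • b', c + t • c', d + t • d', f + t • f', g + t • g', ?_⟩)
  simp only [w3_add₁, w3_add₂, w3_add₃, w3_smul₁, w3_smul₂, w3_smul₃]
  module

/-- `V · {e_p e_q, e_p e_s, e_q e_s}`. -/
abbrev dotTriple (p q s : ℕ) : Submodule ℂ (⋀[ℂ]^3 V) := dot {e2 e p q, e2 e p s, e2 e q s}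

theorem exists_of_mem_dotTriple {p q s : ℕ} {w : ⋀[ℂ]^3 V} (hw : w ∈ dotTriple e p q s) :
    ∃ x y z, w = w3 x (vec e q) (vec e s) + w3 (vec e p) y (vec e s) +
      w3 (vec e p) (vec e q) z := by
  rw [dotTriple, dot_insert, dot_insert, e2_eq_w2, e2_eq_w2, e2_eq_w2] at hw
  obtain ⟨a, ha, b', hb', rfl⟩ := Submodule.mem_sup.mp hw
  obtain ⟨b, hb, c, hc, rfl⟩ := Submodule.mem_sup.mp hb'
  obtain ⟨x, rfl⟩ := mem_dot_singleton.mp ha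
  obtain ⟨y, rfl⟩ := mem_dot_singleton.mp hb
  obtain ⟨z, rfl⟩ := mem_dot_singleton.mp hc
  -- The sign comes from moving `y` past e_p into the middle slot.
  refine ⟨z, -y, x, ?_⟩
  rw [w3_neg_middle, w3_rotate x]
  abel

theorem dotTriple_le {p q s : ℕ} {N : Submodule ℂ (⋀[ℂ]^3 V)}
    (h1 : ∀ v, w3 v (vec e p) (vec e q) ∈ N) (h2 : ∀ v, w3 v (vec e p) (vec e s) ∈ N)
    (h3 : ∀ v, w3 v (vec e q) (vec e s) ∈ N) : dotTriple e p q s ≤ N := by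
  rw [dotTriple, dot_insert, dot_insert, e2_eq_w2, e2_eq_w2, e2_eq_w2]
  exact sup_le (dot_singleton_le h1) (sup_le (dot_singleton_le h2) (dot_singleton_le h3))

theorem w3_mem_dotTriple {p q s a b : ℕ} (ha : a = p ∨ a = q ∨ a = s) (hb : b = p ∨ b = q ∨ b = s)
    (v : V) : w3 v (vec e a) (vec e b) ∈ dotTriple e p q s := by
  have h1 : w3 v (vec e p) (vec e q) ∈ dotTriple e p q s :=
    w3_mem_dot (Or.inl (e2_eq_w2 e p q).symm) v
  have h2 : w3 v (vec e p) (vec e s) ∈ dotTriple e p q s :=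
    w3_mem_dot (Or.inr (Or.inl (e2_eq_w2 e p s).symm)) v
  have h3 : w3 v (vec e q) (vec e s) ∈ dotTriple e p q s :=
    w3_mem_dot (Or.inr (Or.inr (e2_eq_w2 e q s).symm)) v
  have h0 : ∀ c : V, w3 v c c ∈ dotTriple e p q s := fun c ↦ by
    rw [w3_self₂₃]; exact zero_mem _
  rcases ha with rfl | rfl | rfl <;> rcases hb with rfl | rfl | rfl <;>
    first | exact h0 _ | assumption | (apply w3_mem_swap; assumption)

theorem e3_mem_dotTriple {p q s i j k : ℕ}
    (h : ((i = p ∨ i = q ∨ i = s) ∧ (j = p ∨ j = q ∨ j = s)) ∨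
      ((i = p ∨ i = q ∨ i = s) ∧ (k = p ∨ k = q ∨ k = s)) ∨
      ((j = p ∨ j = q ∨ j = s) ∧ (k = p ∨ k = q ∨ k = s))) : e3 e i j k ∈ dotTriple e p q s := by
  rw [e3_eq_w3]
  rcases h with ⟨hi, hj⟩ | ⟨hi, hk⟩ | ⟨hj, hk⟩
  · exact w3_mem_rotate (w3_mem_dotTriple e hi hj _)
  · exact w3_mem_middle (w3_mem_dotTriple e hi hk _)
  · exact w3_mem_dotTriple e hj hk _

theorem tc_eq_zero_of_mem_coneTangentSpace_grassmannian {p q s : ℕ} (hp : 1 ≤ p ∧ p ≤ n)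
    (hq : 1 ≤ q ∧ q ≤ n) (hs : 1 ≤ s ∧ s ≤ n) (hpq : p ≠ q) (hps : p ≠ s) (hqs : q ≠ s)
    {w : ⋀[ℂ]^3 V} (hw : w ∈ coneTangentSpace (grassmannian V 3) (e3 e p q s))
    {i j k : ℕ} (hj : j ≠ p ∧ j ≠ q ∧ j ≠ s) (hk : k ≠ p ∧ k ≠ q ∧ k ≠ s) :
    tri (co e k) (co e i) (co e j) w = 0 := by
  refine contraction_eq_zero_of_mem_coneTangentSpace
    (coneTangentSpace_mono (subset_zariskiClosure _) _ hw) (r := 3) (fun w hw ↦ ?_)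
    -- The contraction has rank 3 at e_p e_q e_s; the cyclic order of the pairs makes the block the
    -- identity without signs. The form for k and the pair (i, j) with j outside the triple both
    -- annihilate the point.
    ![co e p, co e q, co e s] (co e k)
    ![triL (co e q) (co e s), triL (co e s) (co e p), triL (co e p) (co e q)]
    (triL (co e i) (co e j)) ?_ (isContraction_triL _ _) ?_ ?_ ?_ ?_
  · obtain ⟨g, rfl⟩ := mem_cone_grassmannian_iff_map.mp hw
    exact ⟨_, _, rfl⟩
  · intro j; fin_cases j <;> exact isContraction_triL _ _
  all_goals
    try intro i
    try intro j
    try fin_cases i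
    all_goals try fin_cases j
    all_goals simp [triL_apply, e3_eq_w3, tri_w3, co_vec, hp, hq, hs, hj, hk, hpq, hps, hqs,
      hpq.symm, hps.symm, hqs.symm]

theorem coneTangentSpace_grassmannian {p q s : ℕ} (hp : 1 ≤ p ∧ p ≤ n)
    (hq : 1 ≤ q ∧ q ≤ n) (hs : 1 ≤ s ∧ s ≤ n) (hpq : p ≠ q) (hps : p ≠ s) (hqs : q ≠ s) :
    coneTangentSpace (grassmannian V 3) (e3 e p q s) = (dotTriple e p q s : Set (⋀[ℂ]^3 V)) := by
  ext w
  constructor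
  · intro hw
    refine mem_of_forall_tc_eq_zero_or e fun i j k hi hij hjk hk ↦ ?_
    by_cases hcase : ((i = p ∨ i = q ∨ i = s) ∧ (j = p ∨ j = q ∨ j = s)) ∨
      ((i = p ∨ i = q ∨ i = s) ∧ (k = p ∨ k = q ∨ k = s)) ∨
      ((j = p ∨ j = q ∨ j = s) ∧ (k = p ∨ k = q ∨ k = s))
    · exact Or.inr (e3_mem_dotTriple e hcase)
    -- At most one index lies in the triple. A cyclic rotation puts two outside indices where the
    -- tangent equation needs them.
    · left
      have key := fun i j k ↦ tc_eq_zero_of_mem_coneTangentSpace_grassmannian e hp hq hs hpq hps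
        hqs hw (i := i) (j := j) (k := k)
      rw [tc]
      by_cases h1 : i = p ∨ i = q ∨ i = s
      · rw [← tri_rotate]
        exact key i j k (by omega) (by omega)
      · by_cases h2 : j = p ∨ j = q ∨ j = s
        · exact key j k i (by omega) (by omega)
        · rw [← tri_rotate, ← tri_rotate]
          exact key k i j (by omega) (by omega)
  · intro hw
    obtain ⟨x, y, z, rfl⟩ := exists_of_mem_dotTriple e hw
    rw [e3_eq_w3]
    exact mem_coneTangentSpace_grassmannian _ _ _ _ _ _

/-! ### The restricted chordal variety -/

/-- The asserted tangent space of the restricted chordal variety. -/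
abbrev dotFive : Submodule ℂ (⋀[ℂ]^3 V) :=
  dot {e2 e 2 3 + e2 e 4 5, e2 e 1 2, e2 e 1 3, e2 e 1 4, e2 e 1 5}

theorem dotFive_le {N : Submodule ℂ (⋀[ℂ]^3 V)}
    (h : ∀ v, w3 v (vec e 2) (vec e 3) + w3 v (vec e 4) (vec e 5) ∈ N)
    (h2 : ∀ v, w3 v (vec e 1) (vec e 2) ∈ N) (h3 : ∀ v, w3 v (vec e 1) (vec e 3) ∈ N)
    (h4 : ∀ v, w3 v (vec e 1) (vec e 4) ∈ N) (h5 : ∀ v, w3 v (vec e 1) (vec e 5) ∈ N) :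
    dotFive e ≤ N := by
  rw [dotFive, dot_insert, dot_insert, dot_insert, dot_insert]
  simp only [e2_eq_w2]
  exact sup_le (dot_singleton_add_le h) (sup_le (dot_singleton_le h2) (sup_le (dot_singleton_le h3)
    (sup_le (dot_singleton_le h4) (dot_singleton_le h5))))

theorem w3_mem_dotFive {b : ℕ} (hb : b = 2 ∨ b = 3 ∨ b = 4 ∨ b = 5) (v : V) :
    w3 v (vec e 1) (vec e b) ∈ dotFive e :=
  w3_mem_dot (by
    rw [← e2_eq_w2]
    rcases hb with rfl | rfl | rfl | rfl
    exacts [Or.inr (Or.inl rfl), Or.inr (Or.inr (Or.inl rfl)),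
      Or.inr (Or.inr (Or.inr (Or.inl rfl))), Or.inr (Or.inr (Or.inr (Or.inr rfl)))]) v

theorem w3_add_mem_dotFive (v : V) :
    w3 v (vec e 2) (vec e 3) + w3 v (vec e 4) (vec e 5) ∈ dotFive e :=
  w3_add_w3_mem_dot (Or.inl (by rw [e2_eq_w2, e2_eq_w2])) v

theorem dotFive_subset_coneTangentSpace : (dotFive e : Set (⋀[ℂ]^3 V)) ⊆
    coneTangentSpace (restrictedSecant V 2 1 3) (e3 e 1 2 3 + e3 e 1 4 5) := by
  intro w hw
  rw [dotFive, dot_insert, dot_insert, dot_insert, dot_insert] at hw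
  simp only [e2_eq_w2] at hw
  obtain ⟨a, ha, b', hb', rfl⟩ := Submodule.mem_sup.mp hw
  obtain ⟨b, hb, c', hc', rfl⟩ := Submodule.mem_sup.mp hb'
  obtain ⟨c, hc, d', hd', rfl⟩ := Submodule.mem_sup.mp hc'
  obtain ⟨d, hd, f, hf, rfl⟩ := Submodule.mem_sup.mp hd'
  obtain ⟨a, rfl⟩ := mem_dot_singleton_add.mp ha
  obtain ⟨b, rfl⟩ := mem_dot_singleton.mp hb
  obtain ⟨c, rfl⟩ := mem_dot_singleton.mp hc
  obtain ⟨d, rfl⟩ := mem_dot_singleton.mp hd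
  obtain ⟨f, rfl⟩ := mem_dot_singleton.mp hf
  -- The velocities of e₁, …, e₅; those of e₂ and e₄ change sign because they occupy middle slots.
  have h := mem_coneTangentSpace_restrictedSecant (vec e 1) (vec e 2) (vec e 3) (vec e 4) (vec e 5)
    a (-c) b (-f) d
  rw [w3_neg_middle, w3_neg_middle, w3_rotate b, w3_rotate d] at h
  rw [e3_eq_w3, e3_eq_w3]
  convert h using 1
  abel

/-- The contraction has rank 5 at this point with image the span of e₁, …, e₅. Thus every
contraction killing the point pairs to zero on tangent vectors with every coordinate form beyond the
fifth. -/
theorem contraction_eq_zero_of_mem_coneTangentSpace_restrictedSecant (hn : 5 ≤ n) {w : ⋀[ℂ]^3 V}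
    (hw : w ∈ coneTangentSpace (restrictedSecant V 2 1 3) (e3 e 1 2 3 + e3 e 1 4 5))
    {B : Module.Dual ℂ V →ₗ[ℂ] Module.Dual ℂ (⋀[ℂ]^3 V)} (hB : IsContraction B)
    (h0 : ∀ φ, B φ (e3 e 1 2 3 + e3 e 1 4 5) = 0) {k : ℕ} (hk : 6 ≤ k) : B (co e k) w = 0 := by
  rw [restrictedSecant_eq] at hw
  refine contraction_eq_zero_of_mem_coneTangentSpace hw (r := 5) (fun w hw ↦ ?_)
    ![co e 1, co e 2, co e 3, co e 4, co e 5] (co e k)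
    ![triL (co e 2) (co e 3), triL (co e 3) (co e 1), triL (co e 1) (co e 2),
      triL (co e 5) (co e 1), triL (co e 1) (co e 4)] B ?_ hB ?_ (fun _ ↦ h0 _) ?_ (h0 _)
  · obtain ⟨g, rfl⟩ := mem_cone_meetingSecantPoints_iff_map.mp hw
    exact ⟨_, _, rfl⟩
  · intro j; fin_cases j <;> exact isContraction_triL _ _
  · have h1 : 1 ≤ n := by omega
    have h2 : 2 ≤ n := by omega
    have h3 : 3 ≤ n := by omega
    have h4 : 4 ≤ n := by omega
    intro i j
    fin_cases i <;> fin_cases j <;>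
      simp [triL_apply, e3_eq_w3, tri_w3, co_vec, hn, h1, h2, h3, h4]
  · have hk' : ∀ j, j < 6 → k ≠ j := fun j hj ↦ by omega
    intro j
    fin_cases j <;>
      simp [triL_apply, e3_eq_w3, tri_w3, co_vec, hk']

end TangentSpaces

section TangentSpaces

variable {V : Type*} [AddCommGroup V] [Module ℂ V] {n : ℕ} (e : Module.Basis (Fin n) ℂ V)

theorem tri_eq_zero_of_mem_restricted (hn : 5 ≤ n) {w : ⋀[ℂ]^3 V}
    (hw : w ∈ coneTangentSpace (restrictedSecant V 2 1 3) (e3 e 1 2 3 + e3 e 1 4 5))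
    {i j k : ℕ} (hj : 6 ≤ j) (hk : 6 ≤ k) : tri (co e k) (co e i) (co e j) w = 0 := by
  refine contraction_eq_zero_of_mem_coneTangentSpace_restrictedSecant e hn hw
    (isContraction_triL (co e i) (co e j)) (fun φ ↦ ?_) hk
  have h : ∀ l, l < 6 → j ≠ l := fun l hl ↦ by omega
  simp [triL_apply, e3_eq_w3, tri_w3, co_vec, h]

theorem tri_eq_zero_of_mem_restricted' (hn : 5 ≤ n) {w : ⋀[ℂ]^3 V}
    (hw : w ∈ coneTangentSpace (restrictedSecant V 2 1 3) (e3 e 1 2 3 + e3 e 1 4 5))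
    {i j k : ℕ} (hi : i = 2 ∨ i = 3) (hj : j = 4 ∨ j = 5) (hk : 6 ≤ k) :
    tri (co e k) (co e i) (co e j) w = 0 := by
  refine contraction_eq_zero_of_mem_coneTangentSpace_restrictedSecant e hn hw
    (isContraction_triL (co e i) (co e j)) (fun φ ↦ ?_) hk
  rcases hi with rfl | rfl <;> rcases hj with rfl | rfl <;>
    simp [triL_apply, e3_eq_w3, tri_w3, co_vec]

/-- Contracting the point with the coordinate pairs (2,3) and (4,5) gives e₁ both times, so the
difference of the two contractions kills it. -/
theorem tri_eq_tri_of_mem_restricted (hn : 5 ≤ n) {w : ⋀[ℂ]^3 V}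
    (hw : w ∈ coneTangentSpace (restrictedSecant V 2 1 3) (e3 e 1 2 3 + e3 e 1 4 5))
    {k : ℕ} (hk : 6 ≤ k) :
    tri (co e k) (co e 2) (co e 3) w = tri (co e k) (co e 4) (co e 5) w := by
  have h := contraction_eq_zero_of_mem_coneTangentSpace_restrictedSecant e hn hw
    ((isContraction_triL (co e 2) (co e 3)).sub (isContraction_triL (co e 4) (co e 5)))
    (fun φ ↦ ?_) hk
  · rw [LinearMap.sub_apply, LinearMap.sub_apply, triL_apply, triL_apply] at h
    exact sub_eq_zero.mp h
  · have h2 : 2 ≤ n := by omega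
    have h3 : 3 ≤ n := by omega
    have h4 : 4 ≤ n := by omega
    simp [triL_apply, e3_eq_w3, tri_w3, co_vec, h2, h3, h4, hn]

theorem e3_one_mem_dotFive {j : ℕ} (hj : j = 2 ∨ j = 3 ∨ j = 4 ∨ j = 5) (k : ℕ) :
    e3 e 1 j k ∈ dotFive e := by
  rw [e3_eq_w3]
  exact w3_mem_rotate (w3_mem_dotFive e hj _)

/-- Without the index 1, two indices form {2,3} or {4,5}; multiplying e₂e₃ + e₄e₅ by the third basis
vector kills the other summand. -/
theorem e3_mem_dotFive_of_le {i j k : ℕ} (hi : 1 ≤ i) (hij : i < j) (hjk : j < k) (hk : k ≤ 5) :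
    e3 e i j k ∈ dotFive e := by
  by_cases h1 : i = 1
  · subst h1
    exact e3_one_mem_dotFive e (by omega) k
  have h := w3_add_mem_dotFive e
  obtain ⟨rfl, rfl, rfl⟩ | ⟨rfl, rfl, rfl⟩ | ⟨rfl, rfl, rfl⟩ | ⟨rfl, rfl, rfl⟩ :
    (i = 2 ∧ j = 3 ∧ k = 4) ∨ (i = 2 ∧ j = 3 ∧ k = 5) ∨ (i = 2 ∧ j = 4 ∧ k = 5) ∨
      (i = 3 ∧ j = 4 ∧ k = 5) := by omega
  all_goals rw [e3_eq_w3]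
  · have := h (vec e 4)
    rw [w3_self₁₂, add_zero] at this
    exact w3_mem_rotate this
  · have := h (vec e 5)
    rw [w3_self₁₃, add_zero] at this
    exact w3_mem_rotate this
  · have := h (vec e 2)
    rwa [w3_self₁₂, zero_add] at this
  · have := h (vec e 3)
    rwa [w3_self₁₃, zero_add] at this

theorem coneTangentSpace_restrictedSecant (hn : 5 ≤ n) :
    coneTangentSpace (restrictedSecant V 2 1 3) (e3 e 1 2 3 + e3 e 1 4 5) =
      (dotFive e : Set (⋀[ℂ]^3 V)) := by
  refine Set.Subset.antisymm (fun w hw ↦ ?_) (dotFive_subset_coneTangentSpace e)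
  rw [SetLike.mem_coe, eq_sum_tc_smul_e3 e w]
  refine sum_mem fun k hk ↦ ?_
  by_cases hk5 : k ≤ 5
  · refine sum_mem fun j hj ↦ sum_mem fun i hi ↦ Submodule.smul_mem _ _ ?_
    simp only [Finset.mem_Ico] at hi hj
    exact e3_mem_dotFive_of_le e hi.1 hi.2 hj.2 hk5
  · have hk6 : 6 ≤ k := by omega
    have hz : ∀ i j, 6 ≤ j → tc e i j k w = 0 := fun i j hj ↦ by
      rw [tc, ← tri_rotate]
      exact tri_eq_zero_of_mem_restricted e hn hw hj hk6
    have hz' : ∀ i j, (i = 2 ∨ i = 3) → (j = 4 ∨ j = 5) → tc e i j k w = 0 := fun i j hi hj ↦ by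
      rw [tc, ← tri_rotate]
      exact tri_eq_zero_of_mem_restricted' e hn hw hi hj hk6
    have heq : tc e 2 3 k w = tc e 4 5 k w := by
      rw [tc, tc, ← tri_rotate, ← tri_rotate (co e 4)]
      exact tri_eq_tri_of_mem_restricted e hn hw hk6
    have hsub : Finset.Ico 1 6 ⊆ Finset.Ico 1 k := Finset.Ico_subset_Ico_right hk6
    -- For fixed k ≥ 6 only pairs inside {1, …, 5} survive: those containing 1, and (2,3), (4,5)
    -- with equal coefficients.
    rw [← Finset.sum_subset hsub]
    · have hIco : Finset.Ico 1 6 = {1, 2, 3, 4, 5} := by decide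
      have hI2 : Finset.Ico 1 2 = {1} := by decide
      have hI3 : Finset.Ico 1 3 = {1, 2} := by decide
      have hI4 : Finset.Ico 1 4 = {1, 2, 3} := by decide
      have hI5 : Finset.Ico 1 5 = {1, 2, 3, 4} := by decide
      have h1 := fun (c : ℂ) (j : ℕ) (hj : j = 2 ∨ j = 3 ∨ j = 4 ∨ j = 5) ↦
        (dotFive e).smul_mem c (e3_one_mem_dotFive e hj k)
      have h2 := (dotFive e).smul_mem (tc e 4 5 k w) (w3_add_mem_dotFive e (vec e k))
      have hsum : ∑ j ∈ Finset.Ico 1 6, ∑ i ∈ Finset.Ico 1 j, tc e i j k w • e3 e i j k =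
          tc e 1 2 k w • e3 e 1 2 k + tc e 1 3 k w • e3 e 1 3 k + tc e 1 4 k w • e3 e 1 4 k +
          tc e 1 5 k w • e3 e 1 5 k +
          tc e 4 5 k w • (w3 (vec e k) (vec e 2) (vec e 3) + w3 (vec e k) (vec e 4) (vec e 5)) := by
        rw [hIco]
        simp only [Finset.sum_insert, Finset.sum_singleton, hI2, hI3, hI4, hI5,
          Finset.mem_insert, Finset.mem_singleton, Finset.Ico_self, Finset.sum_empty,
          hz' 2 4 (by simp) (by simp), hz' 2 5 (by simp) (by simp), hz' 3 4 (by simp) (by simp),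
          hz' 3 5 (by simp) (by simp), heq, Nat.reduceEqDiff, or_self, not_false_eq_true,
          OfNat.one_ne_ofNat, zero_smul, e3_eq_w3 e 2 3 k, e3_eq_w3 e 4 5 k,
          w3_rotate (vec e k), smul_add]
        abel
      rw [hsum]
      exact add_mem (add_mem (add_mem (add_mem (h1 _ 2 (by simp)) (h1 _ 3 (by simp)))
        (h1 _ 4 (by simp))) (h1 _ 5 (by simp))) h2
    · intro j _ hj
      refine Finset.sum_eq_zero fun i _ ↦ ?_
      simp only [Finset.mem_Ico] at *
      rw [hz i j (by omega), zero_smul]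

/-! ### The chordal variety -/

/-- The asserted tangent space of the chordal variety. -/
abbrev dotSix : Submodule ℂ (⋀[ℂ]^3 V) :=
  dot {e2 e 1 2, e2 e 1 3, e2 e 2 3, e2 e 4 5, e2 e 4 6, e2 e 5 6}

theorem dotSix_eq_sup : dotSix e = dotTriple e 1 2 3 ⊔ dotTriple e 4 5 6 := by
  rw [dotSix, dotTriple, dotTriple, dot_insert, dot_insert, dot_insert, dot_insert (e2 e 1 2),
    dot_insert (e2 e 1 3), sup_assoc, sup_assoc]

theorem dotSix_subset_coneTangentSpace : (dotSix e : Set (⋀[ℂ]^3 V)) ⊆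
    coneTangentSpace (secantVariety 2 (grassmannian V 3)) (e3 e 1 2 3 + e3 e 4 5 6) := by
  intro w hw
  rw [dotSix_eq_sup] at hw
  obtain ⟨a, ha, b, hb, rfl⟩ := Submodule.mem_sup.mp hw
  obtain ⟨x, y, z, rfl⟩ := exists_of_mem_dotTriple e ha
  obtain ⟨x', y', z', rfl⟩ := exists_of_mem_dotTriple e hb
  rw [e3_eq_w3, e3_eq_w3]
  exact mem_coneTangentSpace_secantVariety _ _ _ _ _ _ _ _ _ _ _ _

theorem contraction_eq_zero_of_mem_coneTangentSpace_secantVariety (hn : 6 ≤ n) {w : ⋀[ℂ]^3 V}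
    (hw : w ∈ coneTangentSpace (secantVariety 2 (grassmannian V 3)) (e3 e 1 2 3 + e3 e 4 5 6))
    {B : Module.Dual ℂ V →ₗ[ℂ] Module.Dual ℂ (⋀[ℂ]^3 V)} (hB : IsContraction B)
    (h0 : ∀ φ, B φ (e3 e 1 2 3 + e3 e 4 5 6) = 0) {k : ℕ} (hk : 7 ≤ k) : B (co e k) w = 0 := by
  rw [secantVariety_eq] at hw
  refine contraction_eq_zero_of_mem_coneTangentSpace hw (r := 6) (fun w hw ↦ ?_)
    -- Here the contraction has rank 6, and each triple contributes a cyclic block as for the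
    -- Grassmannian.
    ![co e 1, co e 2, co e 3, co e 4, co e 5, co e 6] (co e k)
    ![triL (co e 2) (co e 3), triL (co e 3) (co e 1), triL (co e 1) (co e 2),
      triL (co e 5) (co e 6), triL (co e 6) (co e 4), triL (co e 4) (co e 5)]
    B ?_ hB ?_ (fun _ ↦ h0 _) ?_ (h0 _)
  · obtain ⟨g, rfl⟩ := mem_cone_secantPoints_iff_map.mp hw
    exact ⟨_, _, rfl⟩
  · intro j; fin_cases j <;> exact isContraction_triL _ _
  · have h1 : 1 ≤ n := by omega
    have h2 : 2 ≤ n := by omega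
    have h3 : 3 ≤ n := by omega
    have h4 : 4 ≤ n := by omega
    have h5 : 5 ≤ n := by omega
    intro i j
    fin_cases i <;> fin_cases j <;>
      simp [triL_apply, e3_eq_w3, tri_w3, co_vec, hn, h1, h2, h3, h4, h5]
  · have hk' : ∀ j, j < 7 → k ≠ j := fun j hj ↦ by omega
    intro j
    fin_cases j <;>
      simp [triL_apply, e3_eq_w3, tri_w3, co_vec, hk']

theorem tri_eq_zero_of_mem_secantVariety (hn : 6 ≤ n) {w : ⋀[ℂ]^3 V}
    (hw : w ∈ coneTangentSpace (secantVariety 2 (grassmannian V 3)) (e3 e 1 2 3 + e3 e 4 5 6))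
    {i j k : ℕ} (hij : 7 ≤ j ∨ ((i = 1 ∨ i = 2 ∨ i = 3) ∧ (j = 4 ∨ j = 5 ∨ j = 6)))
    (hk : 7 ≤ k) : tri (co e k) (co e i) (co e j) w = 0 := by
  refine contraction_eq_zero_of_mem_coneTangentSpace_secantVariety e hn hw
    (isContraction_triL (co e i) (co e j)) (fun φ ↦ ?_) hk
  rcases hij with hj | ⟨rfl | rfl | rfl, rfl | rfl | rfl⟩
  · have h : ∀ l, l < 7 → j ≠ l := fun l hl ↦ by omega
    simp [triL_apply, e3_eq_w3, tri_w3, co_vec, h]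
  all_goals simp [triL_apply, e3_eq_w3, tri_w3, co_vec]

theorem coneTangentSpace_secantVariety (hn : 6 ≤ n) :
    coneTangentSpace (secantVariety 2 (grassmannian V 3)) (e3 e 1 2 3 + e3 e 4 5 6) =
      (dotSix e : Set (⋀[ℂ]^3 V)) := by
  refine Set.Subset.antisymm (fun w hw ↦ ?_) (dotSix_subset_coneTangentSpace e)
  rw [SetLike.mem_coe, dotSix_eq_sup]
  refine mem_of_forall_tc_eq_zero_or e fun i j k hi hij hjk hk ↦ ?_
  by_cases h1 : j ≤ 3
  · exact Or.inr (Submodule.mem_sup_left (e3_mem_dotTriple e (Or.inl ⟨by omega, by omega⟩)))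
  by_cases h2 : 4 ≤ i ∧ j ≤ 6
  · exact Or.inr (Submodule.mem_sup_right (e3_mem_dotTriple e (Or.inl ⟨by omega, by omega⟩)))
  by_cases h3 : 4 ≤ j ∧ k ≤ 6
  · exact Or.inr (Submodule.mem_sup_right
      (e3_mem_dotTriple e (Or.inr (Or.inr ⟨by omega, by omega⟩))))
  -- What remains has k ≥ 7 and either j ≥ 7 or i and j in different triples; such a pair
  -- annihilates the point.
  left
  rw [tc, ← tri_rotate]
  exact tri_eq_zero_of_mem_secantVariety e hn hw (by omega) (by omega)

end TangentSpaces

/-! ### Dimensions, intersections and sums of the tangent spaces -/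

section LinearAlgebra

variable {V : Type*} [AddCommGroup V] [Module ℂ V] {n : ℕ} (e : Module.Basis (Fin n) ℂ V)

theorem finrank_dotTriple {p q s : ℕ} (hp : 1 ≤ p ∧ p ≤ n) (hq : 1 ≤ q ∧ q ≤ n)
    (hs : 1 ≤ s ∧ s ≤ n) (hpq : p ≠ q) (hps : p ≠ s) (hqs : q ≠ s) :
    Module.finrank ℂ (dotTriple e p q s) = 3 * (n - 3) + 1 := by
  let J : Type := {k // k ∈ Finset.Icc 1 n \ {p, q, s}}
  let _ : Fintype J := Finset.fintypeCoeSort _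
  have hJ : ∀ k : J, (1 ≤ (k : ℕ) ∧ (k : ℕ) ≤ n) ∧ (k : ℕ) ≠ p ∧ (k : ℕ) ≠ q ∧ (k : ℕ) ≠ s := by
    rintro ⟨k, hk⟩
    simpa using hk
  have hcard : Fintype.card J = n - 3 := by
    refine (Fintype.card_coe _).trans ?_
    rw [Finset.card_sdiff_of_subset, Nat.card_Icc,
      Finset.card_eq_three.mpr ⟨p, q, s, hpq, hps, hqs, rfl⟩]
    · omega
    · intro k hk
      simp only [Finset.mem_insert, Finset.mem_singleton] at hk
      rw [Finset.mem_Icc]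
      omega
  -- The basis consists of e_p e_q e_s and the products with one factor replaced by one of the n - 3
  -- outside vectors; `d` is the dual family.
  let f : Option (J ⊕ J ⊕ J) → ⋀[ℂ]^3 V
    | none => e3 e p q s
    | some (.inl k) => e3 e k q s
    | some (.inr (.inl k)) => e3 e p k s
    | some (.inr (.inr k)) => e3 e p q k
  let d : Option (J ⊕ J ⊕ J) → Module.Dual ℂ (⋀[ℂ]^3 V)
    | none => tri (co e p) (co e q) (co e s)
    | some (.inl k) => tri (co e k) (co e q) (co e s)
    | some (.inr (.inl k)) => tri (co e p) (co e k) (co e s)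
    | some (.inr (.inr k)) => tri (co e p) (co e q) (co e k)
  have hli : LinearIndependent ℂ f := by
    refine LinearIndependent.of_pairwise_dual_eq_zero_one f d ?_ ?_
    · rintro (_ | i | i | i) (_ | j | j | j) hne
      · exact absurd rfl hne
      all_goals
        simp [f, d, e3_eq_w3, tri_w3, co_vec, hp, hq, hs, hpq, hps, hqs, hpq.symm, hps.symm,
          hqs.symm, hJ, fun k : J ↦ (hJ k).2.1.symm, fun k : J ↦ (hJ k).2.2.1.symm,
          fun k : J ↦ (hJ k).2.2.2.symm]
      all_goals
        refine fun h ↦ hne ?_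
        cases h
        rfl
    · rintro (_ | i | i | i) <;>
        simp [f, d, e3_eq_w3, tri_w3, co_vec, hp, hq, hs, hpq, hps, hqs, hpq.symm, hps.symm,
          hqs.symm, hJ]
  have hspan : Submodule.span ℂ (Set.range f) = dotTriple e p q s := by
    have hf : ∀ i, f i ∈ Submodule.span ℂ (Set.range f) := fun i ↦ Submodule.subset_span ⟨i, rfl⟩
    have hcases : ∀ k, 1 ≤ k → k ≤ n → k = p ∨ k = q ∨ k = s ∨ ∃ j : J, (j : ℕ) = k := by
      intro k h1 h2
      by_cases h : k = p ∨ k = q ∨ k = s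
      · tauto
      · push Not at h
        exact Or.inr (Or.inr (Or.inr ⟨⟨k, by simp [h1, h2, h]⟩, rfl⟩))
    have h0 : w3 (vec e p) (vec e q) (vec e s) ∈ Submodule.span ℂ (Set.range f) :=
      e3_eq_w3 e p q s ▸ hf none
    have h1 (j : J) : w3 (vec e j) (vec e q) (vec e s) ∈ Submodule.span ℂ (Set.range f) :=
      e3_eq_w3 e j q s ▸ hf (some (.inl j))
    have h2 (j : J) : w3 (vec e p) (vec e j) (vec e s) ∈ Submodule.span ℂ (Set.range f) :=
      e3_eq_w3 e p j s ▸ hf (some (.inr (.inl j)))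
    have h3 (j : J) : w3 (vec e p) (vec e q) (vec e j) ∈ Submodule.span ℂ (Set.range f) :=
      e3_eq_w3 e p q j ▸ hf (some (.inr (.inr j)))
    apply le_antisymm
    · rw [Submodule.span_le]
      rintro _ ⟨_ | i | i | i, rfl⟩ <;> exact e3_mem_dotTriple e (by simp)
    · refine dotTriple_le e (w3_mem_of_vec e fun k hk1 hk2 ↦ ?_) (w3_mem_of_vec e fun k hk1 hk2 ↦ ?_)
        (w3_mem_of_vec e fun k hk1 hk2 ↦ ?_)
      · obtain rfl | rfl | rfl | ⟨j, rfl⟩ := hcases k hk1 hk2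
        · rw [w3_self₁₂]; exact zero_mem _
        · rw [w3_self₁₃]; exact zero_mem _
        · exact w3_mem_rotate (w3_mem_rotate h0)
        · exact w3_mem_rotate (w3_mem_rotate (h3 j))
      · obtain rfl | rfl | rfl | ⟨j, rfl⟩ := hcases k hk1 hk2
        · rw [w3_self₁₂]; exact zero_mem _
        · exact w3_mem_middle h0
        · rw [w3_self₁₃]; exact zero_mem _
        · exact w3_mem_middle (h2 j)
      · obtain rfl | rfl | rfl | ⟨j, rfl⟩ := hcases k hk1 hk2
        · exact h0
        · rw [w3_self₁₂]; exact zero_mem _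
        · rw [w3_self₁₃]; exact zero_mem _
        · exact h1 j
  rw [← hspan, finrank_span_eq_card hli]
  simp only [Fintype.card_option, Fintype.card_sum, hcard]
  omega

/-! ### The intersections -/

/-- The products of basis vectors spanning `T̂₁₂₃ ∩ T̂₁₄₅`. -/
abbrev meetSpan : Submodule ℂ (⋀[ℂ]^3 V) :=
  Submodule.span ℂ {e3 e 1 2 4, e3 e 1 2 5, e3 e 1 3 4, e3 e 1 3 5}

theorem tc_eq_zero_of_mem_dotTriple {p q s : ℕ} (hp : 1 ≤ p ∧ p ≤ n) (hq : 1 ≤ q ∧ q ≤ n)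
    (hs : 1 ≤ s ∧ s ≤ n) (hpq : p ≠ q) (hps : p ≠ s) (hqs : q ≠ s) {w : ⋀[ℂ]^3 V}
    (hw : w ∈ dotTriple e p q s) {i j k : ℕ}
    (h : ¬(((i = p ∨ i = q ∨ i = s) ∧ (j = p ∨ j = q ∨ j = s)) ∨
      ((i = p ∨ i = q ∨ i = s) ∧ (k = p ∨ k = q ∨ k = s)) ∨
      ((j = p ∨ j = q ∨ j = s) ∧ (k = p ∨ k = q ∨ k = s)))) : tc e i j k w = 0 := by
  have hw' : w ∈ coneTangentSpace (grassmannian V 3) (e3 e p q s) := by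
    rw [coneTangentSpace_grassmannian e hp hq hs hpq hps hqs]; exact hw
  have key := fun i j k ↦ tc_eq_zero_of_mem_coneTangentSpace_grassmannian e hp hq hs hpq hps
    hqs hw' (i := i) (j := j) (k := k)
  rw [tc]
  by_cases h1 : i = p ∨ i = q ∨ i = s
  · rw [← tri_rotate]
    exact key i j k (by omega) (by omega)
  · by_cases h2 : j = p ∨ j = q ∨ j = s
    · exact key j k i (by omega) (by omega)
    · rw [← tri_rotate, ← tri_rotate]
      exact key k i j (by omega) (by omega)

theorem dotTriple_inf_dotTriple (hn : 5 ≤ n) :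
    dotTriple e 1 2 3 ⊓ dotTriple e 1 4 5 = meetSpan e := by
  apply le_antisymm
  · rintro w ⟨h1, h2⟩
    have key1 := fun i j k ↦ tc_eq_zero_of_mem_dotTriple e (by omega) (by omega) (by omega)
      (by omega) (by omega) (by omega) h1 (i := i) (j := j) (k := k)
    have key2 := fun i j k ↦ tc_eq_zero_of_mem_dotTriple e (by omega) (by omega) (by omega)
      (by omega) (by omega) (by omega) h2 (i := i) (j := j) (k := k)
    refine mem_of_forall_tc_eq_zero_or e fun i j k hi hij hjk hk ↦ ?_
    by_cases hcase : i = 1 ∧ (j = 2 ∨ j = 3) ∧ (k = 4 ∨ k = 5)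
    · right
      obtain ⟨rfl, rfl | rfl, rfl | rfl⟩ := hcase <;> exact Submodule.subset_span (by simp)
    · left
      -- Two indices in each of {1,2,3} and {1,4,5} force 1 and one further index from each.
      -- Otherwise: if i, j ≤ 3, fewer than two lie in {1,4,5}; if j ≥ 4, fewer than two lie in
      -- {1,2,3}.
      by_cases hc : (i ≤ 3 ∧ j ≤ 3)
      · exact key2 i j k (by omega)
      · exact key1 i j k (by omega)
  · rw [meetSpan, Submodule.span_le]
    rintro _ (rfl | rfl | rfl | rfl) <;>
      exact ⟨e3_mem_dotTriple e (by simp), e3_mem_dotTriple e (by simp)⟩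

theorem linearIndependent_meet (hn : 5 ≤ n) :
    LinearIndependent ℂ ![e3 e 1 2 4, e3 e 1 2 5, e3 e 1 3 4, e3 e 1 3 5] := by
  refine LinearIndependent.of_pairwise_dual_eq_zero_one _
    ![tc e 1 2 4, tc e 1 2 5, tc e 1 3 4, tc e 1 3 5] ?_ ?_
  · intro i j hij
    fin_cases i <;> fin_cases j <;> first | exact absurd rfl hij | simp
    all_goals rw [tc_e3_of_lt] <;> first | simp | omega
  · intro i
    fin_cases i <;> simp
    all_goals rw [tc_e3_of_lt] <;> first | simp | omega

theorem finrank_meetSpan (hn : 5 ≤ n) : Module.finrank ℂ (meetSpan e) = 4 := by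
  have h := finrank_span_eq_card (linearIndependent_meet e hn)
  have hr : Set.range ![e3 e 1 2 4, e3 e 1 2 5, e3 e 1 3 4, e3 e 1 3 5] =
      {e3 e 1 2 4, e3 e 1 2 5, e3 e 1 3 4, e3 e 1 3 5} := by
    ext x
    simp only [Set.mem_range, Fin.exists_fin_succ]
    simp [eq_comm]
  rw [hr] at h
  exact h

/-- Three indices cannot have two in each of two disjoint triples. -/
theorem dotTriple_inf_eq_bot (hn : 6 ≤ n) : dotTriple e 1 2 3 ⊓ dotTriple e 4 5 6 = ⊥ := by
  rw [eq_bot_iff]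
  rintro w ⟨h1, h2⟩
  refine mem_of_forall_tc_eq_zero_or e fun i j k hi hij hjk hk ↦ Or.inl ?_
  by_cases hj : j ≤ 3
  · exact tc_eq_zero_of_mem_dotTriple e (by omega) (by omega) (by omega)
      (by omega) (by omega) (by omega) h2 (by omega)
  · exact tc_eq_zero_of_mem_dotTriple e (by omega) (by omega) (by omega)
      (by omega) (by omega) (by omega) h1 (by omega)

/-! ### The complement -/

theorem linearIndependent_extra (hn : 5 ≤ n) : LinearIndependent ℂ
    fun i : {i // i ∈ Finset.Icc 6 n} ↦ e3 e i 2 3 - e3 e i 4 5 := by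
  have h2 : 2 ≤ n := by omega
  have h3 : 3 ≤ n := by omega
  refine LinearIndependent.of_pairwise_dual_eq_zero_one _
    (fun i ↦ tri (co e i) (co e 2) (co e 3)) ?_ ?_
  · rintro ⟨i, hi⟩ ⟨j, hj⟩ hij
    have hij' : i ≠ j := fun h ↦ hij (Subtype.ext h)
    rw [Finset.mem_Icc] at hi hj
    have hl : ∀ l, l < 6 → i ≠ l := fun l hl ↦ by omega
    simp [e3_eq_w3, tri_w3, co_vec, hij', h2, h3, hl]
  · rintro ⟨i, hi⟩
    rw [Finset.mem_Icc] at hi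
    have h1 : 1 ≤ i := by omega
    have hl : ∀ l, l < 6 → l ≠ i := fun l hl ↦ by omega
    simp [e3_eq_w3, tri_w3, co_vec, hi, h1, h2, h3, hl]

theorem extraSpan_eq : extraSpan e = Submodule.span ℂ (Set.range
    fun i : {i // i ∈ Finset.Icc 6 n} ↦ e3 e i 2 3 - e3 e i 4 5) := by
  rw [extraSpan]
  congr 1
  ext x
  constructor
  · rintro ⟨i, h1, h2, rfl⟩
    exact ⟨⟨i, Finset.mem_Icc.mpr ⟨h1, h2⟩⟩, rfl⟩
  · rintro ⟨⟨i, hi⟩, rfl⟩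
    rw [Finset.mem_Icc] at hi
    exact ⟨i, hi.1, hi.2, rfl⟩

theorem finrank_extraSpan (hn : 5 ≤ n) : Module.finrank ℂ (extraSpan e) = n - 5 := by
  rw [extraSpan_eq, finrank_span_eq_card (linearIndependent_extra e hn), Fintype.card_coe,
    Nat.card_Icc]
  omega

theorem tri_eq_tri_of_mem_dotFive (hn : 5 ≤ n) {w : ⋀[ℂ]^3 V} (hw : w ∈ dotFive e) {k : ℕ}
    (hk : 6 ≤ k) : tri (co e k) (co e 2) (co e 3) w = tri (co e k) (co e 4) (co e 5) w :=
  tri_eq_tri_of_mem_restricted e hn (dotFive_subset_coneTangentSpace e hw) hk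

/-- For k ≥ 6 the coordinates (k,2,3) and (k,4,5) are equal on `dotFive` and opposite on
`extraSpan`. -/
theorem dotFive_inf_extraSpan (hn : 5 ≤ n) : dotFive e ⊓ extraSpan e = ⊥ := by
  rw [eq_bot_iff]
  rintro w ⟨h1, h2⟩
  rw [SetLike.mem_coe, extraSpan_eq] at h2
  rw [Submodule.mem_bot]
  obtain ⟨c, rfl⟩ := (Submodule.mem_span_range_iff_exists_fun ℂ).mp h2
  have h2n : 2 ≤ n := by omega
  have h3n : 3 ≤ n := by omega
  have h4n : 4 ≤ n := by omega
  have hval : ∀ k : {i // i ∈ Finset.Icc 6 n},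
      tri (co e k) (co e 2) (co e 3) (∑ i, c i • (e3 e i 2 3 - e3 e i 4 5)) = c k ∧
      tri (co e k) (co e 4) (co e 5) (∑ i, c i • (e3 e i 2 3 - e3 e i 4 5)) = -c k := by
    rintro ⟨k, hk⟩
    rw [Finset.mem_Icc] at hk
    have hk1 : 1 ≤ k := by omega
    have hl : ∀ l, l < 6 → l ≠ k := fun l hl ↦ by omega
    have hl' : ∀ l, l < 6 → k ≠ l := fun l hl ↦ by omega
    constructor
    · rw [map_sum, Finset.sum_eq_single ⟨k, Finset.mem_Icc.mpr hk⟩]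
      · simp [e3_eq_w3, tri_w3, co_vec, hk, hk1, h2n, h3n, hl]
      · rintro ⟨i, hi⟩ - hne
        have hik : k ≠ i := fun h ↦ hne (Subtype.ext h.symm)
        simp [e3_eq_w3, tri_w3, co_vec, hik, h2n, h3n, hl']
      · simp
    · rw [map_sum, Finset.sum_eq_single ⟨k, Finset.mem_Icc.mpr hk⟩]
      · simp [e3_eq_w3, tri_w3, co_vec, hk, hk1, h4n, hn, hl]
      · rintro ⟨i, hi⟩ - hne
        have hik : k ≠ i := fun h ↦ hne (Subtype.ext h.symm)
        simp [e3_eq_w3, tri_w3, co_vec, hik, h4n, hn, hl']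
      · simp
  refine Finset.sum_eq_zero fun k _ ↦ ?_
  have h := tri_eq_tri_of_mem_dotFive e hn h1 (Finset.mem_Icc.mp k.2).1
  rw [(hval k).1, (hval k).2] at h
  rw [self_eq_neg.mp h, zero_smul]

theorem dotTriple_sup_dotTriple :
    dotTriple e 1 2 3 ⊔ dotTriple e 1 4 5 = dotFive e ⊔ extraSpan e := by
  apply le_antisymm
  · have hadd : ∀ k, 1 ≤ k → k ≤ n →
        w3 (vec e k) (vec e 2) (vec e 3) ∈ dotFive e ⊔ extraSpan e ∧
        w3 (vec e k) (vec e 4) (vec e 5) ∈ dotFive e ⊔ extraSpan e := by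
      intro k h1 h2
      -- For k ≤ 5 one of the two products already lies in `dotFive`, hence so does the other. For k
      -- ≥ 6 both are recovered as half the sum and half the difference.
      by_cases hk : k ≤ 5
      · have hsum := w3_add_mem_dotFive e (vec e k)
        have h23 : k ≤ 3 → w3 (vec e k) (vec e 2) (vec e 3) ∈ dotFive e := by
          intro h3
          obtain rfl | rfl | rfl : k = 1 ∨ k = 2 ∨ k = 3 := by omega
          · rw [← e3_eq_w3]; exact e3_one_mem_dotFive e (by simp) 3
          · rw [w3_self₁₂]; exact zero_mem _
          · rw [w3_self₁₃]; exact zero_mem _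
        have h45 : 4 ≤ k → w3 (vec e k) (vec e 4) (vec e 5) ∈ dotFive e := by
          intro h3
          obtain rfl | rfl : k = 4 ∨ k = 5 := by omega
          · rw [w3_self₁₂]; exact zero_mem _
          · rw [w3_self₁₃]; exact zero_mem _
        by_cases h3 : k ≤ 3
        · exact ⟨Submodule.mem_sup_left (h23 h3),
            Submodule.mem_sup_left ((Submodule.add_mem_iff_right _ (h23 h3)).mp hsum)⟩
        · exact ⟨Submodule.mem_sup_left
            ((Submodule.add_mem_iff_left _ (h45 (by omega))).mp hsum),
            Submodule.mem_sup_left (h45 (by omega))⟩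
      · have hs : w3 (vec e k) (vec e 2) (vec e 3) + w3 (vec e k) (vec e 4) (vec e 5) ∈
            dotFive e ⊔ extraSpan e := Submodule.mem_sup_left (w3_add_mem_dotFive e _)
        have hd : w3 (vec e k) (vec e 2) (vec e 3) - w3 (vec e k) (vec e 4) (vec e 5) ∈
            dotFive e ⊔ extraSpan e := Submodule.mem_sup_right (Submodule.subset_span
              ⟨k, by omega, h2, by rw [e3_eq_w3, e3_eq_w3]⟩)
        constructor
        · convert Submodule.smul_mem _ (1 / 2 : ℂ) (add_mem hs hd) using 1
          module
        · convert Submodule.smul_mem _ (1 / 2 : ℂ) (sub_mem hs hd) using 1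
          module
    refine sup_le (dotTriple_le e (fun v ↦ ?_) (fun v ↦ ?_) ?_)
      (dotTriple_le e (fun v ↦ ?_) (fun v ↦ ?_) ?_)
    · exact Submodule.mem_sup_left (w3_mem_dotFive e (by simp) v)
    · exact Submodule.mem_sup_left (w3_mem_dotFive e (by simp) v)
    · exact w3_mem_of_vec e fun k h1 h2 ↦ (hadd k h1 h2).1
    · exact Submodule.mem_sup_left (w3_mem_dotFive e (by simp) v)
    · exact Submodule.mem_sup_left (w3_mem_dotFive e (by simp) v)
    · exact w3_mem_of_vec e fun k h1 h2 ↦ (hadd k h1 h2).2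
  · refine sup_le (dotFive_le e (fun v ↦ ?_) (fun v ↦ ?_) (fun v ↦ ?_) (fun v ↦ ?_) fun v ↦ ?_) ?_
    · exact Submodule.add_mem_sup (w3_mem_dotTriple e (by simp) (by simp) v)
        (w3_mem_dotTriple e (by simp) (by simp) v)
    · exact Submodule.mem_sup_left (w3_mem_dotTriple e (by simp) (by simp) v)
    · exact Submodule.mem_sup_left (w3_mem_dotTriple e (by simp) (by simp) v)
    · exact Submodule.mem_sup_right (w3_mem_dotTriple e (by simp) (by simp) v)
    · exact Submodule.mem_sup_right (w3_mem_dotTriple e (by simp) (by simp) v)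
    · rw [extraSpan, Submodule.span_le]
      rintro _ ⟨i, -, -, rfl⟩
      rw [sub_eq_add_neg]
      exact Submodule.add_mem_sup (e3_mem_dotTriple e (by simp))
        (neg_mem (e3_mem_dotTriple e (by simp)))

/-- 2(3n - 8) - 4 is the dimension of the sum of the two tangent spaces; the complement takes away n
- 5. -/
theorem finrank_dotFive (hn : 5 ≤ n) : Module.finrank ℂ (dotFive e) = 5 * n - 15 := by
  have : FiniteDimensional ℂ V := Module.Basis.finiteDimensional_of_finite e
  have h1 := Submodule.finrank_sup_add_finrank_inf_eq (dotTriple e 1 2 3) (dotTriple e 1 4 5)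
  have h2 := Submodule.finrank_sup_add_finrank_inf_eq (dotFive e) (extraSpan e)
  rw [dotTriple_inf_dotTriple e hn, finrank_meetSpan e hn, dotTriple_sup_dotTriple e,
    finrank_dotTriple e (by omega) (by omega) (by omega) (by omega) (by omega) (by omega),
    finrank_dotTriple e (by omega) (by omega) (by omega) (by omega) (by omega) (by omega)] at h1
  rw [dotFive_inf_extraSpan e hn, finrank_bot, finrank_extraSpan e hn] at h2
  omega

theorem finrank_dotSix (hn : 6 ≤ n) : Module.finrank ℂ (dotSix e) = 6 * n - 16 := by
  have : FiniteDimensional ℂ V := Module.Basis.finiteDimensional_of_finite e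
  have h1 := Submodule.finrank_sup_add_finrank_inf_eq (dotTriple e 1 2 3) (dotTriple e 4 5 6)
  rw [dotTriple_inf_eq_bot e hn, finrank_bot, ← dotSix_eq_sup e,
    finrank_dotTriple e (by omega) (by omega) (by omega) (by omega) (by omega) (by omega),
    finrank_dotTriple e (by omega) (by omega) (by omega) (by omega) (by omega) (by omega)] at h1
  omega

end LinearAlgebra

/-! ## A chart of the orbit of a trivector -/

section Chart

variable {V : Type*} [AddCommGroup V] [Module ℂ V]

theorem w3_sum₁ {α : Type*} (s : Finset α) (f : α → V) (b c : V) :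
    w3 (∑ a ∈ s, f a) b c = ∑ a ∈ s, w3 (f a) b c :=
  map_sum (AddMonoidHom.mk' (fun v ↦ w3 v b c) fun v v' ↦ w3_add₁ v v' b c) f s

theorem w3_sum₂ {α : Type*} (s : Finset α) (f : α → V) (b c : V) :
    w3 b (∑ a ∈ s, f a) c = ∑ a ∈ s, w3 b (f a) c :=
  map_sum (AddMonoidHom.mk' (fun v ↦ w3 b v c) fun v v' ↦ w3_add₂ b v v' c) f s

theorem w3_sum₃ {α : Type*} (s : Finset α) (f : α → V) (b c : V) :
    w3 b c (∑ a ∈ s, f a) = ∑ a ∈ s, w3 b c (f a) :=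
  map_sum (AddMonoidHom.mk' (fun v ↦ w3 b c v) fun v v' ↦ w3_add₃ b c v v') f s

/-- The index set of the coordinates of the chart. -/
abbrev ChartIndex (r m : ℕ) : Type := Set.powersetCard (Fin r) 3 ⊕ Fin m × Fin r

instance (r m : ℕ) : Fintype (ChartIndex r m) := Fintype.ofFinite _

theorem card_chartIndex (r m : ℕ) : Fintype.card (ChartIndex r m) = r.choose 3 + m * r := by
  rw [← Nat.card_eq_fintype_card, Nat.card_sum, Nat.card_prod, Set.powersetCard.card]
  simp

variable {r m : ℕ}

/-- The entries of the generic `(r + m) × r` matrix with an identity block on top. -/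
def chartEntry (i : Fin r) : Fin r ⊕ Fin m → MvPolynomial (ChartIndex r m) ℂ
  | .inl j => if i = j then 1 else 0
  | .inr k => MvPolynomial.X (.inr (k, i))

/-- The elements of a `3`-subset of `Fin r`, in increasing order. -/
abbrev entry (s : Set.powersetCard (Fin r) 3) (i : Fin 3) : Fin r :=
  Set.powersetCard.ofFinEmbEquiv.symm s i

variable (B : Module.Basis (Fin r ⊕ Fin m) ℂ V)

/-- The pullback of polynomial functions on `⋀³ V` to the chart. -/
def chart : MvPolynomial (Module.Dual ℂ (⋀[ℂ]^3 V)) ℂ →ₐ[ℂ] MvPolynomial (ChartIndex r m) ℂ :=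
  MvPolynomial.aeval fun φ ↦ ∑ s, MvPolynomial.X (.inl s) *
    ∑ a, ∑ b, ∑ c, chartEntry (entry s 0) a * chartEntry (entry s 1) b *
      chartEntry (entry s 2) c * MvPolynomial.C (φ (w3 (B a) (B b) (B c)))

/-- The linear maps `ℂ^r → V` that are the identity in the first `r` coordinates of `V`. -/
def IsSection (h : (Fin r → ℂ) →ₗ[ℂ] V) : Prop :=
  ∀ i j : Fin r, B.coord (.inl j) (h (ε i)) = if i = j then 1 else 0

theorem IsSection.eval_chartEntry {h : (Fin r → ℂ) →ₗ[ℂ] V} (hh : IsSection B h)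
    (y : Set.powersetCard (Fin r) 3 → ℂ) (i : Fin r) (a : Fin r ⊕ Fin m) :
    MvPolynomial.eval (Sum.elim y fun p ↦ B.coord (.inr p.1) (h (ε p.2))) (chartEntry i a) =
      B.coord a (h (ε i)) := by
  rcases a with j | k
  · rw [hh i j, chartEntry]
    split_ifs <;> simp
  · simp [chartEntry]

theorem eq_sum_smul_w3 (y : ⋀[ℂ]^3 (Fin r → ℂ)) :
    ∃ c : Set.powersetCard (Fin r) 3 → ℂ,
      y = ∑ s, c s • w3 (ε (entry s 0)) (ε (entry s 1)) (ε (entry s 2)) := by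
  let b := (Pi.basisFun ℂ (Fin r)).exteriorPower 3
  refine ⟨fun s ↦ b.repr y s, ?_⟩
  conv_lhs => rw [← b.sum_repr y]
  refine Finset.sum_congr rfl fun s _ ↦ ?_
  rw [exteriorPower.basis_apply, exteriorPower.ιMulti_family, ιMulti_eq_w3]
  simp [ε, entry]

theorem w3_eq_sum_coord (u v w : V) : w3 u v w = ∑ a, ∑ b, ∑ c,
    (B.coord a u * B.coord b v * B.coord c w) • w3 (B a) (B b) (B c) := by
  conv_lhs => rw [← B.sum_repr u, ← B.sum_repr v, ← B.sum_repr w]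
  rw [w3_sum₁]
  refine Finset.sum_congr rfl fun a _ ↦ ?_
  rw [w3_smul₁, w3_sum₂, Finset.smul_sum]
  refine Finset.sum_congr rfl fun b _ ↦ ?_
  rw [w3_smul₂, w3_sum₃, Finset.smul_sum, Finset.smul_sum]
  refine Finset.sum_congr rfl fun c _ ↦ ?_
  rw [w3_smul₃]
  simp only [Module.Basis.coord_apply]
  module

/-- Evaluating `chart B F` at the coordinates of `y` and the lower entries of `h` gives the value of
`F` at the image of `y` under `h`. -/
theorem evalAt_map_eq_zero_of_isSection {F : MvPolynomial (Module.Dual ℂ (⋀[ℂ]^3 V)) ℂ}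
    (hF : chart B F = 0) {h : (Fin r → ℂ) →ₗ[ℂ] V} (hh : IsSection B h)
    (y : ⋀[ℂ]^3 (Fin r → ℂ)) : evalAt F (exteriorPower.map 3 h y) = 0 := by
  obtain ⟨c, hc⟩ := eq_sum_smul_w3 y
  let p : ChartIndex r m → ℂ := Sum.elim c fun p ↦ B.coord (.inr p.1) (h (ε p.2))
  have hp := congrArg (MvPolynomial.eval p) hF
  rw [map_zero, chart, MvPolynomial.aeval_def, MvPolynomial.hom_eval₂] at hp
  rw [← hp, evalAt, MvPolynomial.eval, MvPolynomial.coe_eval₂Hom]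
  congr 1
  · ext; simp
  · ext φ
    rw [hc]
    simp only [map_sum, map_mul, MvPolynomial.eval_X, MvPolynomial.eval_C,
      map_smul, map_w3, smul_eq_mul]
    refine Finset.sum_congr rfl fun s _ ↦ ?_
    rw [w3_eq_sum_coord B]
    simp only [map_sum, map_smul, smul_eq_mul, p, hh.eval_chartEntry, Sum.elim_inl]

/-- The first `r` coordinates on `V`. -/
def topBlock : V →ₗ[ℂ] (Fin r → ℂ) := LinearMap.pi fun j ↦ B.coord (.inl j)

theorem isSection_of_topBlock_comp {h : (Fin r → ℂ) →ₗ[ℂ] V}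
    (hh : topBlock B ∘ₗ h = LinearMap.id) : IsSection B h := by
  intro i j
  have := congrFun (LinearMap.congr_fun hh (ε i)) j
  simpa [topBlock, ε, Pi.single_apply, eq_comm] using this

/-- With u the invertible top block, g = (g u⁻¹) u and g u⁻¹ is a section; u only changes the
trivector, which the chart leaves arbitrary. -/
theorem evalAt_map_eq_zero_of_isUnit {F : MvPolynomial (Module.Dual ℂ (⋀[ℂ]^3 V)) ℂ}
    (hF : chart B F = 0) {g : (Fin r → ℂ) →ₗ[ℂ] V}
    (hg : IsUnit (topBlock B ∘ₗ g : Module.End ℂ (Fin r → ℂ))) (x : ⋀[ℂ]^3 (Fin r → ℂ)) :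
    evalAt F (exteriorPower.map 3 g x) = 0 := by
  obtain ⟨u, hu⟩ := hg
  have h1 : topBlock B ∘ₗ (g ∘ₗ (↑u⁻¹ : Module.End ℂ (Fin r → ℂ))) = LinearMap.id := by
    rw [← LinearMap.comp_assoc, ← hu]
    exact u.mul_inv
  have h2 : g = (g ∘ₗ (↑u⁻¹ : Module.End ℂ (Fin r → ℂ))) ∘ₗ (u : Module.End ℂ (Fin r → ℂ)) := by
    rw [LinearMap.comp_assoc]
    have h3 : (↑u⁻¹ : Module.End ℂ (Fin r → ℂ)) ∘ₗ (u : Module.End ℂ (Fin r → ℂ)) =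
      LinearMap.id := u.inv_mul
    rw [h3, LinearMap.comp_id]
  rw [h2, exteriorPower.map_comp, LinearMap.comp_apply]
  exact evalAt_map_eq_zero_of_isSection B hF (isSection_of_topBlock_comp B h1) _

theorem evalAt_map_eq_zero {F : MvPolynomial (Module.Dual ℂ (⋀[ℂ]^3 V)) ℂ}
    (hF : chart B F = 0) (g : (Fin r → ℂ) →ₗ[ℂ] V) (x : ⋀[ℂ]^3 (Fin r → ℂ)) :
    evalAt F (exteriorPower.map 3 g x) = 0 := by
  let g₀ : (Fin r → ℂ) →ₗ[ℂ] V := Fintype.linearCombination ℂ fun i ↦ B (.inl i)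
  have hg₀ : topBlock B ∘ₗ g₀ = LinearMap.id := by
    refine LinearMap.pi_ext' fun i ↦ LinearMap.ext_ring (funext fun j ↦ ?_)
    simp [topBlock, g₀, Finsupp.single_apply, Pi.single_apply, eq_comm]
  obtain ⟨w, hw⟩ := exists_map_add_smul_eq g g₀ x
  obtain ⟨q, hq⟩ := exists_polynomial_evalAt_curve F 4 w
  have hq0 : q = 0 := by
    refine Polynomial.eq_zero_of_infinite_isRoot _ ?_
    -- Since `g₀` has identity top block, that of `g + t • g₀` is singular only if -t is an
    -- eigenvalue of the top block of `g`. So `q` vanishes for all but finitely many t, hence at t =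
    -- 0.
    have hfin : (Neg.neg ⁻¹' spectrum ℂ (topBlock B ∘ₗ g : Module.End ℂ (Fin r → ℂ))).Finite :=
      (Module.End.finite_spectrum _).preimage neg_injective.injOn
    refine hfin.infinite_compl.mono fun t ht ↦ ?_
    have hu := spectrum.notMem_iff.mp ht
    rw [Set.mem_ofPred_eq, Polynomial.IsRoot, ← hq, ← hw]
    refine evalAt_map_eq_zero_of_isUnit B hF ?_ x
    rw [← IsUnit.neg_iff]
    have hsub : -(topBlock B ∘ₗ (g + t • g₀) : Module.End ℂ (Fin r → ℂ)) =
        algebraMap ℂ (Module.End ℂ (Fin r → ℂ)) (-t) - topBlock B ∘ₗ g := by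
      rw [LinearMap.comp_add, LinearMap.comp_smul, hg₀, map_neg, Algebra.algebraMap_eq_smul_one,
        neg_add, sub_eq_add_neg, add_comm]
      rfl
    rw [hsub]
    exact hu
  have := hq 0
  rw [← hw, hq0] at this
  simpa using this

end Chart

/-! ### Dimensions of the two secant varieties -/

section Dimension

variable {V : Type*} [AddCommGroup V] [Module ℂ V] {n : ℕ}

/-- The dimension of the closure of the orbit of a trivector under all linear maps, when the
tangent space is large enough. -/
theorem hasDim_zariskiClosure {r : ℕ} (e : Module.Basis (Fin n) ℂ V)
    {S : Set (ℙ ℂ (⋀[ℂ]^3 V))} (hr : r ≤ n) (ξ : ⋀[ℂ]^3 (Fin r → ℂ))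
    (hS : ∀ w, w ∈ cone S ↔ ∃ g : (Fin r → ℂ) →ₗ[ℂ] V, exteriorPower.map 3 g ξ = w)
    {x : ⋀[ℂ]^3 V} {T : Submodule ℂ (⋀[ℂ]^3 V)}
    (hT : (T : Set (⋀[ℂ]^3 V)) ⊆ coneTangentSpace (zariskiClosure S) x) {d : ℕ}
    (hd : Module.finrank ℂ T = d + 1) (hd' : r.choose 3 + (n - r) * r = d + 1) :
    HasDim (zariskiClosure S) d := by
  have : FiniteDimensional ℂ V := Module.Basis.finiteDimensional_of_finite e
  let B : Module.Basis (Fin r ⊕ Fin (n - r)) ℂ V :=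
    e.reindex ((finCongr (by omega)).trans finSumFinEquiv.symm)
  refine hasDim_of_tangent_of_ker_le
    (isPrime_vanishingIdeal_zariskiClosure (fun g ↦ exteriorPower.map 3 g ξ) hS fun g h ↦ ?_)
    hT (chart B) (fun F hF ↦ ?_) hd ((card_chartIndex r (n - r)).trans hd')
  · obtain ⟨w, hw⟩ := exists_map_add_smul_eq g h ξ
    exact ⟨4, w, hw⟩
  · rw [mem_vanishingIdeal_zariskiClosure]
    intro w hw
    obtain ⟨g, rfl⟩ := (hS w).mp hw
    exact evalAt_map_eq_zero B hF g ξ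

theorem hasDim_restrictedSecant (e : Module.Basis (Fin n) ℂ V) (hn : 5 ≤ n) :
    HasDim (restrictedSecant V 2 1 3) (5 * n - 16) := by
  have hT := dotFive_subset_coneTangentSpace e
  rw [restrictedSecant_eq] at hT ⊢
  refine hasDim_zariskiClosure e hn ξ5 (fun w ↦ mem_cone_meetingSecantPoints_iff_map) hT ?_ ?_
  · rw [finrank_dotFive e hn]; omega
  -- 10 + 5(n - 5) = 5n - 15 parameters, exactly the dimension of the tangent space.
  · have : Nat.choose 5 3 = 10 := rfl
    omega

theorem hasDim_secantVariety (e : Module.Basis (Fin n) ℂ V) (hn : 6 ≤ n) :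
    HasDim (secantVariety 2 (grassmannian V 3)) (6 * n - 17) := by
  have hT := dotSix_subset_coneTangentSpace e
  rw [secantVariety_eq] at hT ⊢
  refine hasDim_zariskiClosure e hn ξ6 (fun w ↦ mem_cone_secantPoints_iff_map) hT ?_ ?_
  · rw [finrank_dotSix e hn]; omega
  -- 20 + 6(n - 6) = 6n - 16, again the dimension of the tangent space.
  · have : Nat.choose 6 3 = 20 := rfl
    omega

end Dimension

/-! ## The restricted chordal variety inside the chordal variety -/

section Inclusion

variable {V : Type*} [AddCommGroup V] [Module ℂ V] {n : ℕ}

theorem subset_of_cone_subset {W : Type*} [AddCommGroup W] [Module ℂ W] {S T : Set (ℙ ℂ W)}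
    (h : cone S ⊆ cone T) : S ⊆ T := fun p hp ↦ by
  simpa using h (rep_mem_cone hp) p.rep_nonzero

theorem restrictedSecant_subset_secantVariety :
    restrictedSecant V 2 1 3 ⊆ secantVariety 2 (grassmannian V 3) := by
  rw [restrictedSecant_eq, secantVariety_eq]
  refine zariskiClosure_mono (subset_of_cone_subset fun w hw ↦ ?_)
  obtain ⟨u, a, b, c, d, rfl⟩ := mem_cone_meetingSecantPoints.mp hw
  exact mem_cone_secantPoints.mpr ⟨u, a, b, u, c, d, rfl⟩

/-- Two 3-planes in a space of dimension at most 5 always share a line. -/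
theorem secantPoints_subset_meetingSecantPoints [FiniteDimensional ℂ V]
    (hV : Module.finrank ℂ V ≤ 5) : secantPoints V ⊆ meetingSecantPoints V := by
  rintro p ⟨x, hx, hp⟩
  choose E hE hxE using hx
  refine ⟨E, hE, ?_, by simpa only [hxE] using hp⟩
  rw [iInf_fin_two_eq]
  have h1 := Submodule.finrank_sup_add_finrank_inf_eq (E 0) (E 1)
  have h2 := (E 0 ⊔ E 1).finrank_le
  rw [hE, hE] at h1
  omega

theorem restrictedSecant_eq_secantVariety [FiniteDimensional ℂ V]
    (hV : Module.finrank ℂ V ≤ 5) :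
    restrictedSecant V 2 1 3 = secantVariety 2 (grassmannian V 3) :=
  restrictedSecant_subset_secantVariety.antisymm
    (zariskiClosure_mono (secantPoints_subset_meetingSecantPoints hV))

theorem hasCodimIn_restrictedSecant (e : Module.Basis (Fin n) ℂ V) (hn : 6 ≤ n) :
    HasCodimIn (restrictedSecant V 2 1 3) (secantVariety 2 (grassmannian V 3)) (n - 1) := by
  refine ⟨restrictedSecant_subset_secantVariety, 5 * n - 16,
    hasDim_restrictedSecant e (by omega), ?_⟩
  rw [show 5 * n - 16 + (n - 1) = 6 * n - 17 by omega]
  exact hasDim_secantVariety e hn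

theorem nonempty_linearEquiv_prod {W : Type*} [AddCommGroup W] [Module ℂ W]
    [FiniteDimensional ℂ W] {A B C D : Submodule ℂ W}
    (h : Module.finrank ℂ A = Module.finrank ℂ B + (Module.finrank ℂ C + Module.finrank ℂ D)) :
    Nonempty (A ≃ₗ[ℂ] B × C × D) :=
  FiniteDimensional.nonempty_linearEquiv_of_finrank_eq
    (by rw [Module.finrank_prod, Module.finrank_prod, h])

/-- A pure dimension count: 6n - 16 = (5n - 15) + (n - 5) + 4. -/
theorem nonempty_linearEquiv_dotSix (e : Module.Basis (Fin n) ℂ V) (hn : 6 ≤ n) :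
    Nonempty (dotSix e ≃ₗ[ℂ] dotFive e × extraSpan e × meetSpan e) := by
  have : FiniteDimensional ℂ V := Module.Basis.finiteDimensional_of_finite e
  refine nonempty_linearEquiv_prod ?_
  rw [finrank_dotSix e hn, finrank_dotFive e (by omega), finrank_extraSpan e (by omega),
    finrank_meetSpan e (by omega)]
  omega

end Inclusion

end RestrictedSecant

end

/-! ### The main theorem -/

open RestrictedSecant in
theorem mainTheorem3 {V : Type*} [AddCommGroup V] [Module ℂ V] (n : ℕ) (hn : 5 ≤ n)
    (e : Module.Basis (Fin n) ℂ V) :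
    -- the tangent space of the restricted chordal variety
    coneTangentSpace (restrictedSecant V 2 1 3) (e3 e 1 2 3 + e3 e 1 4 5) =
      (dot {e2 e 2 3 + e2 e 4 5, e2 e 1 2, e2 e 1 3, e2 e 1 4, e2 e 1 5} : Set (⋀[ℂ]^3 V)) ∧
    -- the tangent spaces of the Grassmannian at `e₁e₂e₃` and `e₁e₄e₅`, and their intersection
    coneTangentSpace (grassmannian V 3) (e3 e 1 2 3) =
      (dot {e2 e 1 2, e2 e 1 3, e2 e 2 3} : Set (⋀[ℂ]^3 V)) ∧
    coneTangentSpace (grassmannian V 3) (e3 e 1 4 5) =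
      (dot {e2 e 1 4, e2 e 1 5, e2 e 4 5} : Set (⋀[ℂ]^3 V)) ∧
    coneTangentSpace (grassmannian V 3) (e3 e 1 2 3) ∩ coneTangentSpace (grassmannian V 3) (e3 e 1 4 5) =
      (Submodule.span ℂ {e3 e 1 2 4, e3 e 1 2 5, e3 e 1 3 4, e3 e 1 3 5} : Set (⋀[ℂ]^3 V)) ∧
    LinearIndependent ℂ ![e3 e 1 2 4, e3 e 1 2 5, e3 e 1 3 4, e3 e 1 3 5] ∧
    -- the sum of these two tangent spaces, as an internal direct sum
    coneTangentSpace (grassmannian V 3) (e3 e 1 2 3) + coneTangentSpace (grassmannian V 3) (e3 e 1 4 5) =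
      coneTangentSpace (restrictedSecant V 2 1 3) (e3 e 1 2 3 + e3 e 1 4 5) +
        (extraSpan e : Set (⋀[ℂ]^3 V)) ∧
    coneTangentSpace (restrictedSecant V 2 1 3) (e3 e 1 2 3 + e3 e 1 4 5) ∩
        (extraSpan e : Set (⋀[ℂ]^3 V)) = {0} ∧
    Module.finrank ℂ (extraSpan e) = n - 5 ∧
    -- the tangent space of the chordal variety, and the comparison
    (6 ≤ n →
      coneTangentSpace (secantVariety 2 (grassmannian V 3)) (e3 e 1 2 3 + e3 e 4 5 6) =
        (dot {e2 e 1 2, e2 e 1 3, e2 e 2 3, e2 e 4 5, e2 e 4 6, e2 e 5 6} :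
          Set (⋀[ℂ]^3 V)) ∧
      coneTangentSpace (secantVariety 2 (grassmannian V 3)) (e3 e 1 2 3 + e3 e 4 5 6) =
        coneTangentSpace (grassmannian V 3) (e3 e 1 2 3) +
          coneTangentSpace (grassmannian V 3) (e3 e 4 5 6) ∧
      coneTangentSpace (grassmannian V 3) (e3 e 1 2 3) ∩
        coneTangentSpace (grassmannian V 3) (e3 e 4 5 6) = {0} ∧
      Nonempty (
        Submodule.span ℂ
          (coneTangentSpace (secantVariety 2 (grassmannian V 3)) (e3 e 1 2 3 + e3 e 4 5 6)) ≃ₗ[ℂ]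
        (Submodule.span ℂ
            (coneTangentSpace (restrictedSecant V 2 1 3) (e3 e 1 2 3 + e3 e 1 4 5)) ×
          extraSpan e ×
          Submodule.span ℂ
            (coneTangentSpace (grassmannian V 3) (e3 e 1 2 3) ∩
              coneTangentSpace (grassmannian V 3) (e3 e 1 4 5))))) ∧
    -- dimension and codimension
    HasDim (restrictedSecant V 2 1 3) (5 * n - 16) ∧
    (6 ≤ n →
      HasCodimIn (restrictedSecant V 2 1 3) (secantVariety 2 (grassmannian V 3)) (n - 1)) ∧
    (n = 5 → restrictedSecant V 2 1 3 = secantVariety 2 (grassmannian V 3)) := by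
  have hF := coneTangentSpace_restrictedSecant e hn
  have h1 : coneTangentSpace (grassmannian V 3) (e3 e 1 2 3) = dotTriple e 1 2 3 :=
    coneTangentSpace_grassmannian e (by omega) (by omega) (by omega) (by omega) (by omega)
      (by omega)
  have h2 : coneTangentSpace (grassmannian V 3) (e3 e 1 4 5) = dotTriple e 1 4 5 :=
    coneTangentSpace_grassmannian e (by omega) (by omega) (by omega) (by omega) (by omega)
      (by omega)
  have hmeet : coneTangentSpace (grassmannian V 3) (e3 e 1 2 3) ∩
      coneTangentSpace (grassmannian V 3) (e3 e 1 4 5) = meetSpan e := by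
    rw [h1, h2, ← Submodule.coe_inf, dotTriple_inf_dotTriple e hn]
  refine ⟨hF, h1, h2, hmeet, linearIndependent_meet e hn, ?_, ?_, finrank_extraSpan e hn,
    fun hn6 ↦ ?_, hasDim_restrictedSecant e hn, hasCodimIn_restrictedSecant e, fun h5 ↦ ?_⟩
  · rw [h1, h2, hF, ← Submodule.coe_sup, ← Submodule.coe_sup, dotTriple_sup_dotTriple]
  · rw [hF, ← Submodule.coe_inf, dotFive_inf_extraSpan e hn, Submodule.bot_coe]
  · have h3 : coneTangentSpace (grassmannian V 3) (e3 e 4 5 6) = dotTriple e 4 5 6 :=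
      coneTangentSpace_grassmannian e (by omega) (by omega) (by omega) (by omega) (by omega)
        (by omega)
    have hS := coneTangentSpace_secantVariety e hn6
    refine ⟨hS, ?_, ?_, ?_⟩
    · rw [h1, h3, hS, ← Submodule.coe_sup, dotSix_eq_sup]
    · rw [h1, h3, ← Submodule.coe_inf, dotTriple_inf_eq_bot e hn6, Submodule.bot_coe]
    -- The tangent sets are already subspaces, so taking spans changes nothing.
    · rw [hmeet, hS, hF, Submodule.span_eq, Submodule.span_eq, Submodule.span_eq]
      exact nonempty_linearEquiv_dotSix e hn6
  · have : FiniteDimensional ℂ V := Module.Basis.finiteDimensional_of_finite e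
    refine restrictedSecant_eq_secantVariety ?_
    rw [Module.finrank_eq_card_basis e, Fintype.card_fin, h5]
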